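/- Let $K$ be a compact Hausdorff space and let $C(K)$ be the Banach lattice of continuous real-valued functions on $K$. A Dedekind completion of $C(K)$ is a Dedekind complete Banach lattice $C(K)^\delta$ together with an isometric linear lattice embedding of $C(K)$ into it whose range is majorizing and order dense. A Gleason cover of $K$ is a Stonean space $G_K$ (compact, Hausdorff, the closure of every open set is open) together with a continuous surjection $\pi_K : G_K \to K$ that is irreducible, i.e. $\pi_K[C] \neq K$ for every proper closed subset $C$ of $G_K$. Both exist. Fix any Dedekind completion $C(K)^\delta$ of $C(K)$ and any Gleason cover $G_K$ of $K$. Let $(C(K)^\delta)^*$ be the norm dual of $C(K)^\delta$, with the operator norm and the order in which $\varphi \le \psi$ if and only if $\varphi(f) \le \psi(f)$ for all $f \ge 0$. Let $\mathrm{fa}(\mathrm{RO}(K))$ be the space of bounded finitely additive signed measures on the Boolean algebra $\mathrm{RO}(K)$ of regular open subsets of $K$. Let $\mathcal{C}(K)$ be the algebra of subsets of $K$ with the property of Baire, i.e. the sets $U \mathbin{\Delta} N$ with $U$ open and $N$ meagre, and let $\mathrm{fa}_0(\mathcal{C}(K))$ be the space of bounded finitely additive signed measures on $\mathcal{C}(K)$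 that vanish on every meagre set. For a compact Hausdorff space $X$ let $\mathrm{M}(X)$ be the space of regular signed (real-valued, countably additive) Borel measures on $X$. The spaces of measures carry the pointwise order and the total variation norm. Two spaces are called isometrically lattice isomorphic if both are lattices and there is a norm-preserving linear bijection between them that preserves binary suprema and infima. Then: (i) The spaces $(C(K)^\delta)^*$, $\mathrm{fa}(\mathrm{RO}(K))$, $\mathrm{fa}_0(\mathcal{C}(K))$ and $\mathrm{M}(G_K)$ are pairwise isometrically lattice isomorphic. (ii) If $K$ is Stonean, then $C(K)^*$, $\mathrm{fa}(\mathrm{RO}(K))$ and $\mathrm{M}(K)$ are pairwise isometrically lattice isomorphic. -/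

import Mathlib

open MeasureTheory TopologicalSpace

universe u v w

/-! ### Dedekind completions and Gleason covers -/

/-- `j : C(K) → E` exhibits the Banach lattice `E` as a Dedekind completion of `C(K)`:
`E` is Dedekind complete and `j` is an isometric linear lattice embedding whose range is
majorizing and order dense in `E`. -/
structure IsDedekindCompletion {K : Type u} [TopologicalSpace K] [CompactSpace K]
    {E : Type v} [NormedAddCommGroup E] [NormedSpace ℝ E] [Lattice E]
    (j : C(K, ℝ) →ₗ[ℝ] E) : Prop where
  exists_isLUB : ∀ s : Set E, s.Nonempty → BddAbove s → ∃ e, IsLUB s e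
  norm_map : ∀ f, ‖j f‖ = ‖f‖
  map_sup : ∀ f g, j (f ⊔ g) = j f ⊔ j g
  map_inf : ∀ f g, j (f ⊓ g) = j f ⊓ j g
  majorizing : ∀ e : E, 0 ≤ e → ∃ f, e ≤ j f
  orderDense : ∀ e : E, 0 < e → ∃ f, 0 < j f ∧ j f ≤ e

/-- `π : G → K` exhibits `G` as a Gleason cover (projective cover) of `K`: `G` is Stonean, i.e.
compact, Hausdorff and extremally disconnected, and `π` is an irreducible continuous surjection. -/
structure IsGleasonCover {K : Type u} [TopologicalSpace K] {G : Type v} [TopologicalSpace G]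
    (π : C(G, K)) : Prop where
  compactSpace : CompactSpace G
  t2Space : T2Space G
  extremallyDisconnected : ExtremallyDisconnected G
  surjective : Function.Surjective π
  irreducible : ∀ C : Set G, IsClosed C → C ≠ Set.univ → π '' C ≠ Set.univ

/-! ### Isometric lattice isomorphisms -/

/-- Any two elements have a supremum and an infimum. -/
def HasBinarySupInf (X : Type*) [PartialOrder X] : Prop :=
  ∀ x y : X, (∃ z, IsLUB {x, y} z) ∧ ∃ z, IsGLB {x, y} z

/-- `X` and `Y` are lattices and there is a norm preserving linear bijection `X → Y` that
preserves binary suprema and infima. -/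
def IsometricallyLatticeIsomorphic (X : Type*) [AddCommGroup X] [Module ℝ X] [PartialOrder X]
    [Norm X] (Y : Type*) [AddCommGroup Y] [Module ℝ Y] [PartialOrder Y] [Norm Y] : Prop :=
  HasBinarySupInf X ∧ HasBinarySupInf Y ∧
    ∃ T : X ≃ₗ[ℝ] Y, (∀ x, ‖T x‖ = ‖x‖) ∧
      (∀ x y z, IsLUB {x, y} z → IsLUB {T x, T y} (T z)) ∧
      (∀ x y z, IsGLB {x, y} z → IsGLB {T x, T y} (T z))

/-! ### The dual of a Banach lattice -/

/-- The norm dual of `E`, with the operator norm; it is ordered below by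
`φ ≤ ψ` if and only if `φ f ≤ ψ f` for all `f ≥ 0`. -/
def LatticeDual (E : Type v) [NormedAddCommGroup E] [NormedSpace ℝ E] : Type v := E →L[ℝ] ℝ

namespace LatticeDual

variable {E : Type v} [NormedAddCommGroup E] [NormedSpace ℝ E]

noncomputable instance : NormedAddCommGroup (LatticeDual E) :=
  inferInstanceAs (NormedAddCommGroup (E →L[ℝ] ℝ))

noncomputable instance : NormedSpace ℝ (LatticeDual E) :=
  inferInstanceAs (NormedSpace ℝ (E →L[ℝ] ℝ))

instance : FunLike (LatticeDual E) E ℝ := inferInstanceAs (FunLike (E →L[ℝ] ℝ) E ℝ)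

instance : ContinuousLinearMapClass (LatticeDual E) ℝ E ℝ :=
  inferInstanceAs (ContinuousLinearMapClass (E →L[ℝ] ℝ) ℝ E ℝ)

instance [Lattice E] [IsOrderedAddMonoid E] : PartialOrder (LatticeDual E) where
  le φ ψ := ∀ f : E, 0 ≤ f → φ f ≤ ψ f
  le_refl _ _ _ := le_rfl
  le_trans _ _ _ h₁ h₂ f hf := (h₁ f hf).trans (h₂ f hf)
  le_antisymm φ ψ h₁ h₂ := by
    refine DFunLike.ext _ _ fun f => ?_
    have h : ∀ g : E, 0 ≤ g → φ g = ψ g := fun g hg => le_antisymm (h₁ g hg) (h₂ g hg)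
    rw [← posPart_sub_negPart f, map_sub, map_sub, h _ (posPart_nonneg f),
      h _ (negPart_nonneg f)]

end LatticeDual

/-! ### Bounded finitely additive measures on a Boolean algebra -/

/-- The bounded, finitely additive, real valued functions on a Boolean algebra. -/
def finAddSubmodule (B : Type v) [BooleanAlgebra B] : Submodule ℝ (B → ℝ) where
  carrier := {μ | (∀ a b, Disjoint a b → μ (a ⊔ b) = μ a + μ b) ∧ ∃ C : ℝ, ∀ a, |μ a| ≤ C}
  add_mem' := by
    rintro μ ν ⟨hμ, C, hC⟩ ⟨hν, D, hD⟩
    refine ⟨fun a b hab => ?_, C + D, fun a => ?_⟩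
    · simp only [Pi.add_apply, hμ a b hab, hν a b hab]; ring
    · exact (abs_add_le _ _).trans (add_le_add (hC a) (hD a))
  zero_mem' := ⟨fun a b _ => by simp, 0, fun a => by simp⟩
  smul_mem' := by
    rintro c μ ⟨hμ, C, hC⟩
    refine ⟨fun a b hab => ?_, |c| * C, fun a => ?_⟩
    · simp only [Pi.smul_apply, smul_eq_mul, hμ a b hab]; ring
    · simp only [Pi.smul_apply, smul_eq_mul, abs_mul]
      exact mul_le_mul_of_nonneg_left (hC a) (abs_nonneg c)

/-- The space of bounded finitely additive signed measures on a Boolean algebra, ordered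
pointwise and normed by the total variation. -/
def FinAddMeasure (B : Type v) [BooleanAlgebra B] : Type v := finAddSubmodule B

namespace FinAddMeasure

variable {B : Type v} [BooleanAlgebra B]

noncomputable instance : AddCommGroup (FinAddMeasure B) :=
  inferInstanceAs (AddCommGroup (finAddSubmodule B))

noncomputable instance : Module ℝ (FinAddMeasure B) :=
  inferInstanceAs (Module ℝ (finAddSubmodule B))

instance : CoeFun (FinAddMeasure B) fun _ => B → ℝ := ⟨fun μ => μ.1⟩

instance : PartialOrder (FinAddMeasure B) where
  le μ ν := ∀ a, μ a ≤ ν a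
  le_refl _ _ := le_rfl
  le_trans _ _ _ h₁ h₂ a := (h₁ a).trans (h₂ a)
  le_antisymm _ _ h₁ h₂ := Subtype.ext (funext fun a => le_antisymm (h₁ a) (h₂ a))

/-- The total variation `|μ|(⊤)`: the supremum of `∑ |μ a|` over all finite families of pairwise
disjoint elements (a bounded set of reals, since `μ` is bounded). -/
noncomputable instance : Norm (FinAddMeasure B) where
  norm μ := ⨆ s : {s : Finset B // (s : Set B).PairwiseDisjoint id}, ∑ a ∈ s.1, |μ a|

end FinAddMeasure

/-! ### The algebra of sets with the property of Baire -/

/-- The algebra of all sets of the form `U ∆ N` with `U` open and `N` meagre. -/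
def categoryAlgebra (K : Type u) [TopologicalSpace K] : BooleanSubalgebra (Set K) :=
  have key : ∀ A : Set K,
      (∃ U N : Set K, IsOpen U ∧ IsMeagre N ∧ A = symmDiff U N) ↔ BaireMeasurableSet A := by
    intro A
    rw [BaireMeasurableSet.iff_residualEq_isOpen]
    have h : ∀ U : Set K, A =ᶠ[residual K] U ↔ IsMeagre (symmDiff U A) := by
      intro U
      rw [Filter.eventuallyEq_set, IsMeagre]
      have e : {x | x ∈ A ↔ x ∈ U} = (symmDiff U A)ᶜ := by
        ext x
        simp only [Set.mem_ofPred_eq, Set.mem_compl_iff, Set.mem_symmDiff]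
        tauto
      rw [← e]; rfl
    constructor
    · rintro ⟨U, N, hU, hN, rfl⟩
      exact ⟨U, hU, (h U).2 (by rwa [symmDiff_symmDiff_cancel_left])⟩
    · rintro ⟨U, hU, hA⟩
      exact ⟨U, symmDiff U A, hU, (h U).1 hA, (symmDiff_symmDiff_cancel_left U A).symm⟩
  { carrier := {A | ∃ U N : Set K, IsOpen U ∧ IsMeagre N ∧ A = symmDiff U N}
    supClosed' := fun A hA B hB => (key _).2 (((key _).1 hA).union ((key _).1 hB))
    infClosed' := fun A hA B hB => (key _).2 (((key _).1 hA).inter ((key _).1 hB))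
    compl_mem' := fun hA => (key _).2 ((key _).1 hA).compl
    bot_mem' := (key _).2 isOpen_empty.baireMeasurableSet }

/-- The bounded finitely additive signed measures on the algebra of sets with the property of
Baire that vanish on all meagre sets. -/
def MeagreNullMeasure (K : Type u) [TopologicalSpace K] :
    Submodule ℝ (FinAddMeasure (categoryAlgebra K)) where
  carrier := {μ | ∀ A : categoryAlgebra K, IsMeagre (A : Set K) → μ A = 0}
  add_mem' := by
    intro μ ν hμ hν A hA
    change μ A + ν A = 0
    rw [hμ A hA, hν A hA, add_zero]
  zero_mem' _ _ := rfl
  smul_mem' := by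
    intro c μ hμ A hA
    change c * μ A = 0
    rw [hμ A hA, mul_zero]

/-- The total variation norm. -/
noncomputable instance (K : Type u) [TopologicalSpace K] : Norm (MeagreNullMeasure K) where
  norm μ := ‖μ.1‖

/-! ### Regular signed Borel measures -/

/-- A finite measure dominated by a finite regular measure is regular. -/
theorem regular_of_le {X : Type*} [TopologicalSpace X] [CompactSpace X] [T2Space X]
    [MeasurableSpace X] [BorelSpace X] {m n : Measure X} [IsFiniteMeasure m] [IsFiniteMeasure n]
    (hm : m.Regular) (h : n ≤ m) : n.Regular := by
  have : n.InnerRegularCompactLTTop := by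
    refine ⟨fun A hA r hr => ?_⟩
    have hε : n A - r ≠ 0 := (tsub_pos_of_lt hr).ne'
    obtain ⟨C, hCA, hC, hlt⟩ :=
      hA.1.exists_isCompact_sdiff_lt (μ := m) (measure_ne_top m A) hε
    refine ⟨C, hCA, hC, ?_⟩
    by_contra! hle
    have h1 : n A ≤ n C + n (A \ C) := by
      calc n A = n (C ∪ A \ C) := by rw [Set.union_sdiff_cancel hCA]
        _ ≤ _ := measure_union_le _ _
    have h2 : n (A \ C) < n A - r := (h _).trans_lt hlt
    have h3 : n A < r + (n A - r) :=
      h1.trans_lt (ENNReal.add_lt_add_of_le_of_lt (measure_ne_top n C) hle h2)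
    rw [add_tsub_cancel_of_le hr.le] at h3
    exact lt_irrefl _ h3
  infer_instance

/-- The space of regular signed Borel measures: those signed measures whose total variation
measure is regular. The order (inherited from `SignedMeasure`) is setwise. -/
def RegularSignedMeasure (X : Type u) [TopologicalSpace X] [CompactSpace X] [T2Space X]
    [MeasurableSpace X] [BorelSpace X] : Submodule ℝ (SignedMeasure X) where
  carrier := {μ | μ.totalVariation.Regular}
  add_mem' := by
    intro μ ν hμ hν
    have hμ' : μ.totalVariation.Regular := hμ
    have hν' : ν.totalVariation.Regular := hν
    have hsum : (μ.totalVariation + ν.totalVariation).Regular := by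
      have : (μ.totalVariation + ν.totalVariation).InnerRegular := inferInstance
      infer_instance
    refine regular_of_le hsum ?_
    simp only [SignedMeasure.totalVariation_eq_variation]
    exact VectorMeasure.variation_add_le
  zero_mem' := by
    change (SignedMeasure.totalVariation 0).Regular
    rw [SignedMeasure.totalVariation_zero]
    infer_instance
  smul_mem' := by
    intro c μ hμ
    have hμ' : μ.totalVariation.Regular := hμ
    change (SignedMeasure.totalVariation (c • μ)).Regular
    rw [SignedMeasure.totalVariation_eq_variation, VectorMeasure.variation_smul,
      ← SignedMeasure.totalVariation_eq_variation]
    infer_instance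

/-- The total variation norm `|μ|(X)`. -/
noncomputable instance (X : Type u) [TopologicalSpace X] [CompactSpace X] [T2Space X]
    [MeasurableSpace X] [BorelSpace X] : Norm (RegularSignedMeasure X) where
  norm μ := μ.1.totalVariation.real Set.univ

/-! Every space is compared with `fa(RO(K))`. The map sending `U` to the closure of its preimage
under `π` identifies `RO(K)` with the clopen algebra of the Gleason cover `G`
(`IsGleasonCover.exists_orderIso`): irreducibility says that every nonempty open subset of `G`
contains a whole fibre of `π`. Since `G` is zero-dimensional, the signs of a functional on `C(G)`
and of a regular signed measure on `G` can be read off from the clopen sets, and by compactness each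
positive finitely additive measure on the clopen sets extends to a regular Borel measure. This
treats `M(G)` and `C(G)*`.

For the dual of the completion, `C(G)` is itself a Dedekind completion of `C(K)`, and any two
completions are isometrically order isomorphic: an element is determined by the functions of `C(K)`
below it, and the norm by the order (`IsDedekindCompletion.exists_linearIsometryEquiv`). For the
category algebra, each set with the property of Baire agrees modulo a meagre set with exactly one
regular open set, because `K` is a Baire space.

The measure comparisons rest on `NormOrderIsomorphic.of_linearMap`. Its key is a Jordan
decomposition `μ = p - q` with `p ⊤ + q ⊤ ≤ ‖μ‖`, which reduces isometry to a contraction estimate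
and a bound on differences of positive elements. The lattice property is checked only for finitely
additive measures and is then transported. -/

namespace FinAddMeasure

/-! ### Lattice structure and Jordan decomposition of finitely additive measures -/

variable {B : Type*} [BooleanAlgebra B]

@[simp] theorem zero_apply (a : B) : (0 : FinAddMeasure B) a = 0 := rfl
@[simp] theorem add_apply (μ ν : FinAddMeasure B) (a : B) : (μ + ν) a = μ a + ν a := rfl
@[simp] theorem sub_apply (μ ν : FinAddMeasure B) (a : B) : (μ - ν) a = μ a - ν a := rfl

theorem ext {μ ν : FinAddMeasure B} (h : ∀ a, μ a = ν a) : μ = ν := Subtype.ext (funext h)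

theorem apply_sup (μ : FinAddMeasure B) {a b : B} (h : Disjoint a b) : μ (a ⊔ b) = μ a + μ b :=
  μ.2.1 a b h

theorem exists_abs_le (μ : FinAddMeasure B) : ∃ C : ℝ, ∀ a, |μ a| ≤ C := μ.2.2

@[simp] theorem apply_bot (μ : FinAddMeasure B) : μ ⊥ = 0 := by
  have := μ.apply_sup (disjoint_bot_left : Disjoint (⊥ : B) ⊥)
  rw [sup_idem] at this
  linarith

theorem apply_sdiff (μ : FinAddMeasure B) {a b : B} (h : b ≤ a) : μ (a \ b) = μ a - μ b := by
  have := μ.apply_sup (disjoint_sdiff_self_right : Disjoint b (a \ b))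
  rw [sup_sdiff_cancel_right h] at this
  linarith

theorem apply_mono {μ : FinAddMeasure B} (hμ : 0 ≤ μ) {a b : B} (h : b ≤ a) : μ b ≤ μ a := by
  have : 0 ≤ μ (a \ b) := hμ _
  rw [apply_sdiff _ h] at this
  linarith

theorem sum_apply (μ : FinAddMeasure B) {s : Finset B}
    (hs : (s : Set B).PairwiseDisjoint id) : ∑ a ∈ s, μ a = μ (s.sup id) := by
  classical
  induction s using Finset.induction_on with
  | empty => simp
  | insert a s ha ih =>
    rw [Finset.sum_insert ha, ih (hs.subset (by simp)), Finset.sup_insert, apply_sup]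
    · rfl
    · rw [Finset.disjoint_sup_right]
      intro b hb
      exact hs (by simp) (by simp [hb]) (by rintro rfl; exact ha hb)

/-- The positive part of a measure takes at `a` the supremum of the values at elements below `a`. -/
theorem exists_posPart (μ : FinAddMeasure B) :
    ∃ p : FinAddMeasure B, ∀ a, IsLUB (μ.1 '' Set.Iic a) (p a) := by
  obtain ⟨C, hC⟩ := μ.exists_abs_le
  have hlub : ∀ a, IsLUB (μ.1 '' Set.Iic a) (sSup (μ.1 '' Set.Iic a)) := fun a =>
    isLUB_csSup ⟨_, Set.mem_image_of_mem _ (le_refl a)⟩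
      ⟨C, by rintro _ ⟨b, -, rfl⟩; exact (le_abs_self _).trans (hC b)⟩
  refine ⟨⟨fun a => sSup (μ.1 '' Set.Iic a), fun a b hab => ?_, C, fun a => ?_⟩, hlub⟩
  · refine (hlub _).unique ⟨?_, fun x hx => ?_⟩
    · rintro _ ⟨d, hd, rfl⟩
      have hd' : d = d ⊓ a ⊔ d ⊓ b := by rw [← inf_sup_left]; exact (inf_eq_left.2 hd).symm
      have := μ.apply_sup (hab.mono (inf_le_right : d ⊓ a ≤ a) (inf_le_right : d ⊓ b ≤ b))
      rw [← hd'] at this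
      rw [this]
      exact add_le_add ((hlub a).1 ⟨_, inf_le_right, rfl⟩) ((hlub b).1 ⟨_, inf_le_right, rfl⟩)
    -- The elements below `a` and below `b` vary independently, so the two suprema are bounded one
    -- at a time.
    · rw [← le_sub_iff_add_le]
      refine (hlub a).2 ?_
      rintro _ ⟨d, hd, rfl⟩
      rw [le_sub_comm]
      refine (hlub b).2 ?_
      rintro _ ⟨e, he, rfl⟩
      have := hx ⟨d ⊔ e, sup_le_sup hd he, rfl⟩
      rw [apply_sup _ (hab.mono hd he)] at this
      linarith
  · rw [abs_le]
    constructor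
    · exact (neg_le_of_abs_le (hC a)).trans ((hlub a).1 ⟨a, le_refl a, rfl⟩)
    · exact (hlub a).2 (by rintro _ ⟨b, -, rfl⟩; exact (le_abs_self _).trans (hC b))

/-- A positive `q ≥ μ` is monotone, so `μ b ≤ q b ≤ q a` whenever `b ≤ a`. -/
theorem isLUB_of_forall_isLUB {μ p : FinAddMeasure B}
    (h : ∀ a, IsLUB (μ.1 '' Set.Iic a) (p a)) : IsLUB {μ, 0} p := by
  constructor
  · rintro ν (rfl | rfl) a
    · exact (h a).1 ⟨a, le_refl a, rfl⟩
    · exact (h a).1 ⟨⊥, bot_le, apply_bot μ⟩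
  · intro q hq a
    have h0 : 0 ≤ q := hq (by simp)
    refine (h a).2 ?_
    rintro _ ⟨b, hb, rfl⟩
    exact (hq (show μ ∈ {μ, 0} by simp) b).trans (apply_mono h0 hb)

instance : IsOrderedAddMonoid (FinAddMeasure B) where
  add_le_add_left _ _ h ρ a := add_le_add_left (h a) (ρ a)

/-- Translation reduces suprema to positive parts, `μ ⊔ ν = (μ - ν)⁺ + ν`; negation turns suprema
into infima. -/
theorem hasBinarySupInf (B : Type*) [BooleanAlgebra B] : HasBinarySupInf (FinAddMeasure B) := by
  have hsup : ∀ μ ν : FinAddMeasure B, ∃ p, IsLUB {μ, ν} p := by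
    intro μ ν
    obtain ⟨p, hp⟩ := exists_posPart (μ - ν)
    have hp := isLUB_of_forall_isLUB hp
    refine ⟨p + ν, ?_, fun q hq => ?_⟩
    · rintro ρ (rfl | rfl)
      · exact sub_le_iff_le_add.1 (hp.1 (by simp))
      · exact le_add_of_nonneg_left (hp.1 (by simp))
    · rw [← le_sub_iff_add_le]
      refine hp.2 ?_
      rintro ρ (rfl | rfl)
      · exact sub_le_sub_right (hq (by simp)) _
      · exact sub_nonneg.2 (hq (by simp))
  refine fun μ ν => ⟨hsup μ ν, ?_⟩
  obtain ⟨p, hp⟩ := hsup (-μ) (-ν)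
  refine ⟨-p, ?_, fun q hq => ?_⟩
  · rintro ρ (rfl | rfl)
    · exact neg_le.1 (hp.1 (by simp))
    · exact neg_le.1 (hp.1 (by simp))
  · refine le_neg.1 (hp.2 ?_)
    rintro ρ (rfl | rfl)
    · exact neg_le_neg (hq (by simp))
    · exact neg_le_neg (hq (by simp))

theorem sum_abs_sub_le {p q : FinAddMeasure B} (hp : 0 ≤ p) (hq : 0 ≤ q) {s : Finset B}
    (hs : (s : Set B).PairwiseDisjoint id) : ∑ a ∈ s, |(p - q) a| ≤ p ⊤ + q ⊤ := by
  calc ∑ a ∈ s, |(p - q) a| ≤ ∑ a ∈ s, (p a + q a) := by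
        refine Finset.sum_le_sum fun a _ => ?_
        have h1 : 0 ≤ p a := hp a
        have h2 : 0 ≤ q a := hq a
        rw [sub_apply, abs_le]
        constructor <;> linarith
    _ = p (s.sup id) + q (s.sup id) := by
        rw [Finset.sum_add_distrib, sum_apply p hs, sum_apply q hs]
    _ ≤ _ := add_le_add (apply_mono hp le_top) (apply_mono hq le_top)

theorem norm_sub_le_add {p q : FinAddMeasure B} (hp : 0 ≤ p) (hq : 0 ≤ q) :
    ‖p - q‖ ≤ p ⊤ + q ⊤ := by
  have : Nonempty {s : Finset B // (s : Set B).PairwiseDisjoint id} := ⟨⟨∅, by simp⟩⟩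
  exact ciSup_le fun s => sum_abs_sub_le hp hq s.2

/-- With `p` the positive part and `q = p - μ`, the number `p ⊤ + q ⊤ = 2 p ⊤ - μ ⊤` is the supremum
of `2 μ b - μ ⊤ = μ b - μ bᶜ`, and the disjoint family `{b, bᶜ}` bounds each of these by `‖μ‖`. -/
theorem exists_nonneg_sub (μ : FinAddMeasure B) :
    ∃ p q : FinAddMeasure B, 0 ≤ p ∧ 0 ≤ q ∧ μ = p - q ∧ p ⊤ + q ⊤ ≤ ‖μ‖ := by
  classical
  obtain ⟨p, hp⟩ := exists_posPart μ
  have hp' := isLUB_of_forall_isLUB hp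
  have h0 : 0 ≤ p := hp'.1 (by simp)
  have h1 : 0 ≤ p - μ := sub_nonneg.2 (hp'.1 (by simp))
  have hμ : μ = p - (p - μ) := by abel
  refine ⟨p, p - μ, h0, h1, hμ, ?_⟩
  have hbdd : BddAbove (Set.range fun s : {s : Finset B // (s : Set B).PairwiseDisjoint id} =>
      ∑ a ∈ s.1, |μ a|) := by
    refine ⟨p ⊤ + (p - μ) ⊤, ?_⟩
    rintro _ ⟨s, rfl⟩
    have := sum_abs_sub_le h0 h1 s.2
    rwa [← hμ] at this
  have key : ∀ b, μ b - μ bᶜ ≤ ‖μ‖ := by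
    intro b
    have hs : ((({b, bᶜ} : Finset B)) : Set B).PairwiseDisjoint id := by
      intro x hx y hy hxy
      simp only [Finset.coe_insert, Finset.coe_singleton, Set.mem_insert_iff,
        Set.mem_singleton_iff] at hx hy
      rcases hx with rfl | rfl <;> rcases hy with rfl | rfl
      · exact absurd rfl hxy
      · exact disjoint_compl_right
      · exact disjoint_compl_left
      · exact absurd rfl hxy
    have h := le_ciSup hbdd ⟨_, hs⟩
    refine le_trans ?_ h
    -- In the trivial algebra `{b, bᶜ}` collapses to a singleton, but then the difference is `0`.
    by_cases hb : b = bᶜ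
    · rw [sub_eq_zero.2 (congrArg μ.1 hb)]
      exact Finset.sum_nonneg fun _ _ => abs_nonneg _
    · rw [Finset.sum_pair hb]
      linarith [le_abs_self (μ b), neg_abs_le (μ bᶜ)]
  have h2 : p ⊤ ≤ (‖μ‖ + μ ⊤) / 2 := by
    refine (hp ⊤).2 ?_
    rintro _ ⟨b, -, rfl⟩
    have h3 := key b
    have h4 := μ.apply_sup (disjoint_compl_right : Disjoint b bᶜ)
    rw [sup_compl_eq_top] at h4
    change μ b ≤ _
    linarith
  rw [sub_apply]
  linarith

theorem sum_abs_le_norm (μ : FinAddMeasure B) {s : Finset B}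
    (hs : (s : Set B).PairwiseDisjoint id) : ∑ a ∈ s, |μ a| ≤ ‖μ‖ := by
  obtain ⟨p, q, hp, hq, rfl, h⟩ := exists_nonneg_sub μ
  exact (sum_abs_sub_le hp hq hs).trans h

theorem norm_le {μ : FinAddMeasure B} {C : ℝ}
    (h : ∀ s : Finset B, (s : Set B).PairwiseDisjoint id → ∑ a ∈ s, |μ a| ≤ C) : ‖μ‖ ≤ C := by
  have : Nonempty {s : Finset B // (s : Set B).PairwiseDisjoint id} := ⟨⟨∅, by simp⟩⟩
  exact ciSup_le fun s => h s.1 s.2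

end FinAddMeasure

/-! ### Norm preserving linear order isomorphisms -/

/-- There is a norm preserving linear order isomorphism from `X` onto `Y`. -/
def NormOrderIsomorphic (X : Type*) [AddCommGroup X] [Module ℝ X] [PartialOrder X]
    [Norm X] (Y : Type*) [AddCommGroup Y] [Module ℝ Y] [PartialOrder Y] [Norm Y] : Prop :=
  ∃ T : X ≃ₗ[ℝ] Y, (∀ x, ‖T x‖ = ‖x‖) ∧ ∀ x y, T x ≤ T y ↔ x ≤ y

namespace NormOrderIsomorphic

variable {X : Type*} [AddCommGroup X] [Module ℝ X] [PartialOrder X] [Norm X]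
  {Y : Type*} [AddCommGroup Y] [Module ℝ Y] [PartialOrder Y] [Norm Y]
  {Z : Type*} [AddCommGroup Z] [Module ℝ Z] [PartialOrder Z] [Norm Z]

theorem symm (h : NormOrderIsomorphic X Y) : NormOrderIsomorphic Y X := by
  obtain ⟨T, hT, hle⟩ := h
  refine ⟨T.symm, fun y => ?_, fun x y => ?_⟩
  · rw [← hT, T.apply_symm_apply]
  · rw [← hle, T.apply_symm_apply, T.apply_symm_apply]

theorem trans (h : NormOrderIsomorphic X Y) (h' : NormOrderIsomorphic Y Z) :
    NormOrderIsomorphic X Z := by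
  obtain ⟨T, hT, hle⟩ := h
  obtain ⟨S, hS, hle'⟩ := h'
  refine ⟨T.trans S, fun x => ?_, fun x y => ?_⟩
  · rw [LinearEquiv.trans_apply, hS, hT]
  · rw [LinearEquiv.trans_apply, LinearEquiv.trans_apply, hle', hle]

theorem hasBinarySupInf (h : NormOrderIsomorphic X Y) (hY : HasBinarySupInf Y) :
    HasBinarySupInf X := by
  obtain ⟨T, -, hle⟩ := h
  let e : X ≃o Y := ⟨T.toEquiv, hle _ _⟩
  intro x y
  obtain ⟨⟨z, hz⟩, w, hw⟩ := hY (e x) (e y)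
  refine ⟨⟨e.symm z, ?_⟩, e.symm w, ?_⟩
  · rwa [← e.isLUB_image', Set.image_pair, e.apply_symm_apply]
  · rwa [← e.isGLB_image', Set.image_pair, e.apply_symm_apply]

theorem isometricallyLatticeIsomorphic (h : NormOrderIsomorphic X Y) (hY : HasBinarySupInf Y) :
    IsometricallyLatticeIsomorphic X Y := by
  refine ⟨h.hasBinarySupInf hY, hY, ?_⟩
  obtain ⟨T, hT, hle⟩ := h
  let e : X ≃o Y := ⟨T.toEquiv, hle _ _⟩
  refine ⟨T, hT, fun x y z hz => ?_, fun x y z hz => ?_⟩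
  · have := e.isLUB_image'.2 hz
    rwa [Set.image_pair] at this
  · have := e.isGLB_image'.2 hz
    rwa [Set.image_pair] at this

/-- A criterion for a linear map into a space of finitely additive measures to be a norm
preserving order isomorphism. -/
theorem of_linearMap {B : Type*} [BooleanAlgebra B] [IsOrderedAddMonoid X]
    (T : X →ₗ[ℝ] FinAddMeasure B) (hT : ∀ x, 0 ≤ T x ↔ 0 ≤ x)
    (hsurj : ∀ μ : FinAddMeasure B, 0 ≤ μ → ∃ x, T x = μ) (hnorm : ∀ x, ‖T x‖ ≤ ‖x‖)
    (hsub : ∀ x y : X, 0 ≤ x → 0 ≤ y → ‖x - y‖ ≤ T x ⊤ + T y ⊤) :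
    NormOrderIsomorphic X (FinAddMeasure B) := by
  have hle : ∀ x y, T x ≤ T y ↔ x ≤ y := fun x y => by
    rw [← sub_nonneg, ← map_sub, hT, sub_nonneg]
  have hinj : Function.Injective T := fun x y h =>
    le_antisymm ((hle x y).1 h.le) ((hle y x).1 h.ge)
  have hbij : Function.Bijective T := by
    refine ⟨hinj, fun μ => ?_⟩
    obtain ⟨p, q, hp, hq, rfl, -⟩ := μ.exists_nonneg_sub
    obtain ⟨x, rfl⟩ := hsurj p hp
    obtain ⟨y, rfl⟩ := hsurj q hq
    exact ⟨x - y, map_sub _ _ _⟩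
  refine ⟨LinearEquiv.ofBijective T hbij, fun x => le_antisymm (hnorm x) ?_, hle⟩
  -- The decomposition of `T x` pulls back to `x = y - z` with `y, z ≥ 0`, whence `‖x‖ ≤ T y ⊤ + T z
  -- ⊤ ≤ ‖T x‖`.
  obtain ⟨p, q, hp, hq, h, hpq⟩ := (T x).exists_nonneg_sub
  obtain ⟨y, rfl⟩ := hsurj p hp
  obtain ⟨z, rfl⟩ := hsurj q hq
  rw [← map_sub] at h
  rw [hinj h]
  refine (hsub y z ((hT y).1 hp) ((hT z).1 hq)).trans (hpq.trans ?_)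
  rw [LinearEquiv.ofBijective_apply, hinj h]

end NormOrderIsomorphic

/-! ### Transport along an isomorphism of Boolean algebras -/

theorem FinAddMeasure.normOrderIsomorphic_of_orderIso {B B' : Type*} [BooleanAlgebra B]
    [BooleanAlgebra B'] (e : B' ≃o B) :
    NormOrderIsomorphic (FinAddMeasure B) (FinAddMeasure B') := by
  have hdisj : ∀ {a b : B'}, Disjoint a b → Disjoint (e a) (e b) := fun h =>
    (disjoint_map_orderIso_iff e).2 h
  let T : FinAddMeasure B →ₗ[ℝ] FinAddMeasure B' :=
    { toFun := fun μ => ⟨fun a => μ (e a), fun a b hab => by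
          change μ (e (a ⊔ b)) = μ (e a) + μ (e b)
          rw [e.map_sup, μ.apply_sup (hdisj hab)],
        μ.exists_abs_le.imp fun C hC a => hC _⟩
      map_add' := fun _ _ => rfl
      map_smul' := fun _ _ => rfl }
  have hT : ∀ μ a, T μ a = μ (e a) := fun _ _ => rfl
  refine .of_linearMap T (fun μ => ⟨fun h a => ?_, fun h a => h _⟩) (fun μ hμ => ?_)
    (fun μ => FinAddMeasure.norm_le fun s hs => ?_) (fun μ ν hμ hν => ?_)
  · have := h (e.symm a)
    rwa [hT, e.apply_symm_apply] at this
  · refine ⟨⟨fun a => μ (e.symm a), fun a b hab => ?_,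
      μ.exists_abs_le.imp fun C hC a => hC _⟩, FinAddMeasure.ext fun a => ?_⟩
    · change μ (e.symm (a ⊔ b)) = μ (e.symm a) + μ (e.symm b)
      rw [e.symm.map_sup, μ.apply_sup ((disjoint_map_orderIso_iff e.symm).2 hab)]
    · exact congrArg μ.1 (e.symm_apply_apply a)
  · have h := μ.sum_abs_le_norm (s := s.map e.toEquiv.toEmbedding) (by
      intro a ha b hb hab
      simp only [Finset.coe_map, Set.mem_image] at ha hb
      obtain ⟨a, ha, rfl⟩ := ha
      obtain ⟨b, hb, rfl⟩ := hb
      exact hdisj (hs ha hb fun h => hab (h ▸ rfl)))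
    rw [Finset.sum_map] at h
    exact h
  · rw [hT, hT, e.map_top]
    exact FinAddMeasure.norm_sub_le_add hμ hν

/-! ### Regular open sets and the property of Baire -/

section RegularOpen

variable {K : Type*} [TopologicalSpace K]

/-- The Heyting complement of an open set is the interior of its set complement, so the double
complement is the interior of the closure. -/
theorem Heyting.Regular.interior_closure (U : Heyting.Regular (Opens K)) :
    interior (closure ((U : Opens K) : Set K)) = ((U : Opens K) : Set K) := by
  conv_rhs => rw [← U.prop.eq]
  simp only [Opens.coe_compl_eq_interior_compl, interior_compl, compl_compl]

theorem Heyting.Regular.coe_toRegular_eq (U : Opens K) :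
    ((Heyting.Regular.toRegular U : Opens K) : Set K) = interior (closure (U : Set K)) := by
  simp only [Heyting.Regular.coe_toRegular, Opens.coe_compl_eq_interior_compl, interior_compl,
    compl_compl]

theorem Heyting.Regular.coe_sup_eq (U V : Heyting.Regular (Opens K)) :
    ((↑(U ⊔ V) : Opens K) : Set K) =
      interior (closure (((U : Opens K) : Set K) ∪ ((V : Opens K) : Set K))) := by
  simp only [Heyting.Regular.coe_sup, Opens.coe_compl_eq_interior_compl, interior_compl,
    compl_compl, Opens.coe_sup]

theorem Heyting.Regular.disjoint_iff_coe (U V : Heyting.Regular (Opens K)) :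
    Disjoint U V ↔ Disjoint ((U : Opens K) : Set K) ((V : Opens K) : Set K) := by
  rw [disjoint_iff, ← Heyting.Regular.coe_inj, Opens.coe_disjoint, disjoint_iff]
  rfl

theorem Heyting.Regular.le_of_subset_closure {U V : Heyting.Regular (Opens K)}
    (h : ((U : Opens K) : Set K) ⊆ closure ((V : Opens K) : Set K)) : U ≤ V := by
  rw [← Heyting.Regular.coe_le_coe, ← SetLike.coe_subset_coe, ← V.interior_closure]
  exact interior_maximal h (U : Opens K).2

theorem IsOpen.isMeagre_frontier {U : Set K} (hU : IsOpen U) : IsMeagre (frontier U) := by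
  refine IsNowhereDense.isMeagre ?_
  rw [isClosed_frontier.isNowhereDense_iff, ← frontier_compl]
  exact interior_frontier hU.isClosed_compl

theorem symmDiff_interior_closure_subset {U : Set K} (hU : IsOpen U) :
    symmDiff U (interior (closure U)) ⊆ frontier U := by
  rintro x (⟨h1, h2⟩ | ⟨h1, h2⟩)
  · exact absurd (hU.subset_interior_closure h1) h2
  · exact ⟨interior_subset h1, by rwa [hU.interior_eq]⟩

/-- An open set, as an element of the algebra of sets with the property of Baire. -/
def categoryAlgebra.ofOpens (U : Opens K) : categoryAlgebra K :=
  ⟨U, U, ∅, U.2, IsMeagre.empty, (symmDiff_bot (U : Set K)).symm⟩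

@[simp] theorem categoryAlgebra.coe_ofOpens (U : Opens K) :
    (categoryAlgebra.ofOpens U : Set K) = U := rfl

/-- Passing from `U ∆ N` to the interior of the closure of `U` changes only points of `N` and of the
frontier of `U`, both meagre. -/
theorem categoryAlgebra.exists_regular (A : categoryAlgebra K) :
    ∃ U : Heyting.Regular (Opens K), IsMeagre (symmDiff (A : Set K) ((U : Opens K) : Set K)) := by
  obtain ⟨_, U, N, hU, hN, rfl⟩ := A
  refine ⟨Heyting.Regular.toRegular ⟨U, hU⟩, (hN.union hU.isMeagre_frontier).mono ?_⟩
  rw [Heyting.Regular.coe_toRegular_eq]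
  refine (symmDiff_triangle _ U _).trans (Set.union_subset_union ?_ ?_)
  · change symmDiff (symmDiff U N) U ⊆ N
    rw [symmDiff_comm, symmDiff_symmDiff_cancel_left]
  · exact symmDiff_interior_closure_subset hU

theorem MeagreNullMeasure.apply_congr (ν : MeagreNullMeasure K) {A B : categoryAlgebra K}
    (h : IsMeagre (symmDiff (A : Set K) (B : Set K))) : ν.1 A = ν.1 B := by
  have h1 : ν.1 (A \ (A ⊓ B)) = 0 := ν.2 _ (h.mono (by
    rintro x ⟨hx, hx'⟩
    exact Or.inl ⟨hx, fun hB => hx' ⟨hx, hB⟩⟩))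
  have h2 : ν.1 (B \ (A ⊓ B)) = 0 := ν.2 _ (h.mono (by
    rintro x ⟨hx, hx'⟩
    exact Or.inr ⟨hx, fun hA => hx' ⟨hA, hx⟩⟩))
  rw [FinAddMeasure.apply_sdiff _ inf_le_left] at h1
  rw [FinAddMeasure.apply_sdiff _ inf_le_right] at h2
  linarith

/-- Otherwise `U` minus the closure of `V` would be a nonempty meagre open set. -/
theorem Heyting.Regular.le_of_isMeagre_symmDiff [BaireSpace K] {U V : Heyting.Regular (Opens K)}
    (h : IsMeagre (symmDiff ((U : Opens K) : Set K) ((V : Opens K) : Set K))) : U ≤ V := by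
  refine Heyting.Regular.le_of_subset_closure fun x hx => ?_
  by_contra hxV
  refine not_isMeagre_of_isOpen ((U : Opens K).2.inter isClosed_closure.isOpen_compl) ⟨x, hx, hxV⟩
    (h.mono ?_)
  rintro y ⟨hy, hyV⟩
  exact Or.inl ⟨hy, fun h => hyV (subset_closure h)⟩

theorem Heyting.Regular.eq_of_isMeagre_symmDiff [BaireSpace K] {A : Set K}
    {U V : Heyting.Regular (Opens K)} (hU : IsMeagre (symmDiff A ((U : Opens K) : Set K)))
    (hV : IsMeagre (symmDiff A ((V : Opens K) : Set K))) : U = V := by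
  have h : IsMeagre (symmDiff ((U : Opens K) : Set K) ((V : Opens K) : Set K)) := by
    refine (hU.union hV).mono ((symmDiff_triangle _ A _).trans ?_)
    rw [symmDiff_comm _ A]
    rfl
  exact le_antisymm (le_of_isMeagre_symmDiff h)
    (le_of_isMeagre_symmDiff (by rwa [symmDiff_comm]))

theorem symmDiff_union_union_subset {α : Type*} (A B C D : Set α) :
    symmDiff (A ∪ B) (C ∪ D) ⊆ symmDiff A C ∪ symmDiff B D := by
  intro x
  simp only [Set.mem_symmDiff, Set.mem_union]
  tauto

/-- Restricting a measure that vanishes on the meagre sets to the regular open sets. -/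
def MeagreNullMeasure.restrict :
    MeagreNullMeasure K →ₗ[ℝ] FinAddMeasure (Heyting.Regular (Opens K)) where
  toFun ν := ⟨fun U => ν.1 (categoryAlgebra.ofOpens U), fun U V hUV => by
    rw [Heyting.Regular.disjoint_iff_coe] at hUV
    rw [← FinAddMeasure.apply_sup]
    -- The join of regular open sets exceeds their union, but only by points of the frontier of the
    -- union.
    · refine MeagreNullMeasure.apply_congr ν ?_
      rw [symmDiff_comm]
      refine ((U : Opens K).2.union (V : Opens K).2).isMeagre_frontier.mono ?_
      refine subset_trans ?_ (symmDiff_interior_closure_subset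
        ((U : Opens K).2.union (V : Opens K).2))
      rw [categoryAlgebra.coe_ofOpens, Heyting.Regular.coe_sup_eq]
      rfl
    · rw [disjoint_iff, Subtype.ext_iff]
      exact disjoint_iff.1 hUV,
    ν.1.exists_abs_le.imp fun C hC a => hC _⟩
  map_add' _ _ := rfl
  map_smul' _ _ := rfl

theorem MeagreNullMeasure.restrict_apply (ν : MeagreNullMeasure K)
    (U : Heyting.Regular (Opens K)) :
    MeagreNullMeasure.restrict ν U = ν.1 (categoryAlgebra.ofOpens U) := rfl

/-- The regular open representative is unique, so choosing it respects joins and disjointness and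
kills meagre sets; composing `μ` with it gives the preimage. -/
theorem MeagreNullMeasure.restrict_surjective [BaireSpace K] :
    Function.Surjective (MeagreNullMeasure.restrict (K := K)) := by
  intro μ
  choose reg hreg using categoryAlgebra.exists_regular (K := K)
  have hsup : ∀ A B, reg (A ⊔ B) = reg A ⊔ reg B := by
    intro A B
    refine Heyting.Regular.eq_of_isMeagre_symmDiff (hreg _) ?_
    have hO := (reg A : Opens K).2.union (reg B : Opens K).2
    refine (((hreg A).union (hreg B)).union hO.isMeagre_frontier).mono ?_
    rw [Heyting.Regular.coe_sup_eq]
    refine (symmDiff_triangle _ (((reg A : Opens K) : Set K) ∪ ((reg B : Opens K) : Set K)) _).trans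
      (Set.union_subset_union ?_ ?_)
    · exact symmDiff_union_union_subset _ _ _ _
    · exact symmDiff_interior_closure_subset hO
  have hdisj : ∀ A B, Disjoint A B → Disjoint (reg A) (reg B) := by
    intro A B hAB
    rw [Heyting.Regular.disjoint_iff_coe, Set.disjoint_iff_inter_eq_empty]
    have hAB' : ∀ x, x ∈ (A : Set K) → x ∉ (B : Set K) := by
      intro x hA hB
      have := congrArg Subtype.val (disjoint_iff.1 hAB)
      change (A : Set K) ∩ B = ∅ at this
      exact Set.notMem_empty x (this ▸ ⟨hA, hB⟩)
    by_contra hne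
    refine not_isMeagre_of_isOpen ((reg A : Opens K).2.inter (reg B : Opens K).2)
      (Set.nonempty_iff_ne_empty.2 hne) (((hreg A).union (hreg B)).mono ?_)
    rintro x ⟨hxA, hxB⟩
    by_cases hx : x ∈ (A : Set K)
    · exact Or.inr (Or.inr ⟨hxB, hAB' x hx⟩)
    · exact Or.inl (Or.inr ⟨hxA, hx⟩)
  refine ⟨⟨⟨fun A => μ (reg A), fun A B hAB => ?_, μ.exists_abs_le.imp fun C hC a => hC _⟩, ?_⟩, ?_⟩
  · change μ (reg (A ⊔ B)) = μ (reg A) + μ (reg B)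
    rw [hsup, μ.apply_sup (hdisj A B hAB)]
  · intro A hA
    have : reg A = ⊥ := by
      refine Heyting.Regular.eq_of_isMeagre_symmDiff (hreg A) ?_
      rw [Heyting.Regular.coe_bot, Opens.coe_bot]
      change IsMeagre (symmDiff (A : Set K) ⊥)
      rwa [symmDiff_bot]
    exact (congrArg μ.1 this).trans μ.apply_bot
  · refine FinAddMeasure.ext fun U => congrArg μ.1 ?_
    refine Heyting.Regular.eq_of_isMeagre_symmDiff (hreg _) ?_
    rw [categoryAlgebra.coe_ofOpens, symmDiff_self]
    exact IsMeagre.empty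

instance : IsOrderedAddMonoid (MeagreNullMeasure K) where
  add_le_add_left _ _ h ρ a := add_le_add_left (h a) (ρ.1 a)

theorem MeagreNullMeasure.normOrderIsomorphic [BaireSpace K] :
    NormOrderIsomorphic (MeagreNullMeasure K) (FinAddMeasure (Heyting.Regular (Opens K))) := by
  classical
  refine .of_linearMap MeagreNullMeasure.restrict (fun ν => ⟨fun h A => ?_, fun h U => h _⟩)
    (fun μ _ => MeagreNullMeasure.restrict_surjective μ)
    (fun ν => FinAddMeasure.norm_le fun s hs => ?_) (fun μ ν hμ hν => ?_)
  · obtain ⟨U, hU⟩ := categoryAlgebra.exists_regular A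
    rw [apply_congr ν (B := categoryAlgebra.ofOpens U) hU]
    exact h U
  · have hinj : Function.Injective
        fun U : Heyting.Regular (Opens K) => categoryAlgebra.ofOpens (U : Opens K) := by
      intro U V h
      exact Heyting.Regular.coe_injective (Opens.ext (congrArg Subtype.val h))
    have h := ν.1.sum_abs_le_norm (s := s.map ⟨_, hinj⟩) (by
      intro a ha b hb hab
      simp only [Finset.coe_map, Set.mem_image] at ha hb
      obtain ⟨a, ha, rfl⟩ := ha
      obtain ⟨b, hb, rfl⟩ := hb
      have := hs ha hb fun h => hab (h ▸ rfl)
      change Disjoint a b at this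
      rw [Heyting.Regular.disjoint_iff_coe] at this
      change Disjoint (categoryAlgebra.ofOpens (a : Opens K)) (categoryAlgebra.ofOpens (b : Opens K))
      rw [disjoint_iff, Subtype.ext_iff]
      exact disjoint_iff.1 this)
    rw [Finset.sum_map] at h
    exact h
  · have h : categoryAlgebra.ofOpens ((⊤ : Heyting.Regular (Opens K)) : Opens K) = ⊤ := rfl
    rw [restrict_apply, restrict_apply, h]
    exact FinAddMeasure.norm_sub_le_add hμ hν

end RegularOpen

/-! ### Gleason covers -/

namespace IsGleasonCover

variable {K : Type*} [TopologicalSpace K] {G : Type*} [TopologicalSpace G]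
  {π : C(G, K)}

/-- The set `(π '' Vᶜ)ᶜ` consists of the points whose whole fibre lies in `V`; it is open because
`π` is a closed map. -/
theorem isOpen_compl_image_compl [T2Space K] (h : IsGleasonCover π) {V : Set G} (hV : IsOpen V) :
    IsOpen (π '' Vᶜ)ᶜ := by
  have := h.compactSpace
  exact (hV.isClosed_compl.isCompact.image π.continuous).isClosed.isOpen_compl

theorem nonempty_compl_image_compl (h : IsGleasonCover π) {V : Set G} (hV : IsOpen V)
    (hne : V.Nonempty) : (π '' Vᶜ)ᶜ.Nonempty :=
  Set.nonempty_compl.2 (h.irreducible _ hV.isClosed_compl (Set.compl_ne_univ.2 hne))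

theorem preimage_compl_image_compl_subset (V : Set G) : π ⁻¹' (π '' Vᶜ)ᶜ ⊆ V := by
  intro x hx
  by_contra hxV
  exact hx ⟨x, hxV, rfl⟩

/-- For a neighbourhood `V` of a point of `C`, irreducibility puts a whole fibre inside `V ∩ C`, so
the fibres contained in `C` are dense in `C`. -/
theorem closure_preimage_compl_image_compl (h : IsGleasonCover π) {C : Set G} (hC : IsClopen C) :
    closure (π ⁻¹' (π '' Cᶜ)ᶜ) = C := by
  refine (closure_minimal (preimage_compl_image_compl_subset C) hC.isClosed).antisymm ?_
  intro x hx
  rw [mem_closure_iff]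
  intro V hV hxV
  obtain ⟨y, hy⟩ := h.nonempty_compl_image_compl (hV.inter hC.isOpen) ⟨x, hxV, hx⟩
  obtain ⟨z, rfl⟩ := h.surjective y
  have hz := preimage_compl_image_compl_subset (V ∩ C) hy
  refine ⟨z, hz.1, fun hz' => hy ?_⟩
  exact Set.image_mono (Set.compl_subset_compl.2 Set.inter_subset_right) hz'

theorem image_eq_closure [T2Space K] (h : IsGleasonCover π) {C : Set G} (hC : IsClopen C) :
    π '' C = closure (π '' Cᶜ)ᶜ := by
  have := h.compactSpace
  refine Set.Subset.antisymm ?_ (closure_minimal ?_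
    (hC.isClosed.isCompact.image π.continuous).isClosed)
  · conv_lhs => rw [← h.closure_preimage_compl_image_compl hC]
    refine (image_closure_subset_closure_image π.continuous).trans (closure_mono ?_)
    exact Set.image_preimage_subset _ _
  · intro y hy
    obtain ⟨x, rfl⟩ := h.surjective y
    exact ⟨x, preimage_compl_image_compl_subset C hy, rfl⟩

/-- The regular open subsets of `K` correspond to the clopen subsets of a Gleason cover. -/
theorem exists_orderIso [T2Space K] (h : IsGleasonCover π) :
    Nonempty (Heyting.Regular (Opens K) ≃o Clopens G) := by
  have := h.compactSpace
  have := h.extremallyDisconnected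
  have hopen : ∀ U : Heyting.Regular (Opens K), IsOpen (π ⁻¹' ((U : Opens K) : Set K)) :=
    fun U => (U : Opens K).2.preimage π.continuous
  let f : Heyting.Regular (Opens K) → Clopens G := fun U =>
    ⟨closure (π ⁻¹' ((U : Opens K) : Set K)), isClosed_closure,
      ExtremallyDisconnected.open_closure _ (hopen U)⟩
  have hf : ∀ U V, f U ≤ f V ↔ U ≤ V := by
    refine fun U V => ⟨fun hUV => Heyting.Regular.le_of_subset_closure fun x hx => ?_,
      fun hUV => closure_mono (Set.preimage_mono hUV)⟩
    obtain ⟨y, rfl⟩ := h.surjective x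
    have : y ∈ closure (π ⁻¹' ((V : Opens K) : Set K)) := hUV (subset_closure hx)
    exact closure_mono (Set.image_preimage_subset _ _)
      (image_closure_subset_closure_image π.continuous ⟨y, this, rfl⟩)
  have hsurj : Function.Surjective f := by
    intro C
    have hC := C.isClopen
    -- Since `π '' Cᶜ` is the closure of `U'`, the preimage of `C` is the Heyting complement `U'ᶜ`,
    -- which is automatically regular.
    let U' : Opens K := ⟨(π '' (C : Set G)ᶜᶜ)ᶜ, h.isOpen_compl_image_compl hC.compl.isOpen⟩
    refine ⟨⟨U'ᶜ, Heyting.isRegular_compl _⟩, Clopens.ext ?_⟩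
    change closure (π ⁻¹' ((U'ᶜ : Opens K) : Set K)) = (C : Set G)
    have : ((U'ᶜ : Opens K) : Set K) = (π '' (C : Set G)ᶜ)ᶜ := by
      rw [Opens.coe_compl_eq_interior_compl, interior_compl, h.image_eq_closure hC.compl]
      rfl
    rw [this]
    exact h.closure_preimage_compl_image_compl hC
  let e : Heyting.Regular (Opens K) ↪o Clopens G := OrderEmbedding.ofMapLEIff f hf
  exact ⟨RelIso.ofSurjective e hsurj⟩

/-- The identity is a Gleason cover of a Stonean space. -/
theorem id_of_extremallyDisconnected (K : Type*) [TopologicalSpace K] [CompactSpace K] [T2Space K]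
    [ExtremallyDisconnected K] : IsGleasonCover (ContinuousMap.id K) where
  compactSpace := inferInstance
  t2Space := inferInstance
  extremallyDisconnected := inferInstance
  surjective := Function.surjective_id
  irreducible C _ hC := by simpa using hC

end IsGleasonCover

/-! ### Existence of Gleason covers -/

/-- If `f` moved `x`, some open neighbourhood of `x` would be disjoint from its image under `f`.
Deleting it keeps `ρ` surjective, since `f y` replaces each deleted `y`, against irreducibility. -/
theorem eq_self_of_irreducible {E A : Type*} [TopologicalSpace E] [T2Space E] [TopologicalSpace A]
    {ρ : E → A} (hsurj : Function.Surjective ρ)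
    (hirr : ∀ E₀ : Set E, E₀ ≠ Set.univ → IsClosed E₀ → ρ '' E₀ ≠ Set.univ)
    {f : E → E} (hf : Continuous f) (hρf : ∀ x, ρ (f x) = ρ x) (x : E) : f x = x := by
  by_contra hne
  obtain ⟨U, V, hU, hV, hxU, hxV, hUV⟩ := t2_separation hne
  refine hirr (V ∩ f ⁻¹' U)ᶜ (Set.compl_ne_univ.2 ⟨x, hxV, hxU⟩)
    (hV.inter (hU.preimage hf)).isClosed_compl (Set.eq_univ_of_forall fun a => ?_)
  obtain ⟨y, rfl⟩ := hsurj a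
  by_cases hy : y ∈ V ∩ f ⁻¹' U
  · exact ⟨f y, fun h => hUV.le_bot ⟨hy.2, h.1⟩, hρf y⟩
  · exact ⟨y, hy, rfl⟩

/-- The Stone-Čech compactification `D` of the discrete set `K` is projective and maps onto `K`. A
minimal closed `E ⊆ D` still mapping onto `K` is a retract of `D`: lifting `p` through its
restriction to `E` gives `r : D → E`, which fixes `E` by irreducibility. Hence `E` is projective, so
extremally disconnected. -/
theorem exists_isGleasonCover (K : Type u) [TopologicalSpace K] [CompactSpace K] [T2Space K] :
    ∃ (G : Type u) (_ : TopologicalSpace G) (π : C(G, K)), IsGleasonCover π := by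
  obtain ⟨D, _, _, _, p, hp, hpsurj, hproj⟩ :
      ∃ (D : Type u) (_ : TopologicalSpace D) (_ : CompactSpace D) (_ : T2Space D) (p : D → K),
        Continuous p ∧ Function.Surjective p ∧ CompactT2.Projective D := by
    -- The copy of `K` keeps the discrete topology apart from the given one.
    let d : TopologicalSpace (ULift.{0} K) := ⊥
    have : DiscreteTopology (ULift.{0} K) := ⟨rfl⟩
    have hc : Continuous (ULift.down : ULift.{0} K → K) := continuous_of_discreteTopology
    refine ⟨StoneCech (ULift.{0} K), inferInstance, inferInstance, inferInstance,
      stoneCechExtend hc, continuous_stoneCechExtend hc, fun x => ⟨stoneCechUnit ⟨x⟩, ?_⟩,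
      StoneCech.projective⟩
    exact congrFun (stoneCechExtend_extends hc) ⟨x⟩
  obtain ⟨E, hE, hEuniv, hirr⟩ := exists_compact_surjective_zorn_subset hp hpsurj
  have hρ : Continuous (E.domRestrict p) := hp.comp continuous_subtype_val
  have hρsurj : Function.Surjective (E.domRestrict p) := by
    intro a
    obtain ⟨x, hx, rfl⟩ := hEuniv.ge (Set.mem_univ a)
    exact ⟨⟨x, hx⟩, rfl⟩
  obtain ⟨r, hr, hrp⟩ := hproj hp hρ hρsurj
  have hrE : ∀ x : E, r x = x := eq_self_of_irreducible hρsurj hirr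
    (hr.comp continuous_subtype_val) fun x => congrFun hrp x
  have hEproj : CompactT2.Projective E := by
    intro Y Z _ _ _ _ _ _ f g hf hg hgsurj
    obtain ⟨h, hh, hgh⟩ := hproj (hf.comp hr) hg hgsurj
    refine ⟨h ∘ Subtype.val, hh.comp continuous_subtype_val, funext fun x => ?_⟩
    have := congrFun hgh (x : D)
    simp only [Function.comp_apply, hrE] at this ⊢
    exact this
  exact ⟨E, inferInstance, ⟨_, hρ⟩, hE, inferInstance, hEproj.extremallyDisconnected, hρsurj,
    fun C hC hne => hirr C hne hC⟩

/-! ### Regular measures on totally disconnected compact spaces -/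

section Clopens

variable {G : Type*} [TopologicalSpace G] [CompactSpace G] [T2Space G]

theorem TopologicalSpace.Clopens.exists_between [TotallyDisconnectedSpace G] {Z U : Set G} (hZ : IsClosed Z) (hU : IsOpen U) (h : Z ⊆ U) :
    ∃ c : Clopens G, Z ⊆ c ∧ (c : Set G) ⊆ U := by
  obtain ⟨C, hC, h1, h2⟩ := exists_clopen_of_closed_subset_open hZ hU h
  exact ⟨⟨C, hC⟩, h1, h2⟩

theorem TopologicalSpace.Clopens.disjoint_coe_iff {X : Type*} [TopologicalSpace X] {a b : Clopens X} :
    Disjoint (a : Set X) (b : Set X) ↔ Disjoint a b := by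
  rw [disjoint_iff, disjoint_iff, Clopens.ext_iff]
  rfl

theorem TopologicalSpace.Clopens.measurableSet_coe {X : Type*} [TopologicalSpace X] [MeasurableSpace X]
    [BorelSpace X] (c : Clopens X) : MeasurableSet (c : Set X) :=
  c.isClopen.isOpen.measurableSet

theorem FinAddMeasure.apply_sup_le {B : Type*} [BooleanAlgebra B] {μ : FinAddMeasure B}
    (hμ : 0 ≤ μ) (a b : B) : μ (a ⊔ b) ≤ μ a + μ b := by
  have h1 := μ.apply_sup (disjoint_sdiff_self_right : Disjoint a (b \ a))
  rw [sup_sdiff_self_right] at h1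
  have h2 := apply_mono hμ (sdiff_le : b \ a ≤ b)
  linarith

/-- The content that a positive finitely additive measure on the clopen sets induces. -/
noncomputable def FinAddMeasure.content [TotallyDisconnectedSpace G] (μ : FinAddMeasure (Clopens G))
    (hμ : 0 ≤ μ) : Content G where
  toFun Z := ⨅ c : {c : Clopens G // (Z : Set G) ⊆ c}, (μ c.1).toNNReal
  mono' Z₁ Z₂ h := by
    have : Nonempty {c : Clopens G // (Z₂ : Set G) ⊆ c} := ⟨⟨⊤, fun _ _ => trivial⟩⟩
    exact le_ciInf fun c => ciInf_le (OrderBot.bddBelow _)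
      (⟨c.1, h.trans c.2⟩ : {c : Clopens G // (Z₁ : Set G) ⊆ c})
  sup_le' Z₁ Z₂ := by
    have : Nonempty {c : Clopens G // (Z₁ : Set G) ⊆ c} := ⟨⟨⊤, fun _ _ => trivial⟩⟩
    have : Nonempty {c : Clopens G // (Z₂ : Set G) ⊆ c} := ⟨⟨⊤, fun _ _ => trivial⟩⟩
    refine NNReal.le_iInf_add_iInf fun c d => ?_
    refine (ciInf_le (OrderBot.bddBelow _) (⟨c.1 ⊔ d.1, Set.union_subset_union c.2 d.2⟩ :
      {c : Clopens G // ((Z₁ ⊔ Z₂ : Compacts G) : Set G) ⊆ c})).trans ?_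
    rw [← Real.toNNReal_add (hμ _) (hμ _)]
    exact Real.toNNReal_le_toNNReal (apply_sup_le hμ _ _)
  sup_disjoint' Z₁ Z₂ hd h₁ h₂ := by
    have hn1 : Nonempty {c : Clopens G // (Z₁ : Set G) ⊆ c} := ⟨⟨⊤, fun _ _ => trivial⟩⟩
    have hn2 : Nonempty {c : Clopens G // (Z₂ : Set G) ⊆ c} := ⟨⟨⊤, fun _ _ => trivial⟩⟩
    have hn3 : Nonempty {c : Clopens G // ((Z₁ ⊔ Z₂ : Compacts G) : Set G) ⊆ c} :=
      ⟨⟨⊤, fun _ _ => trivial⟩⟩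
    refine le_antisymm ?_ (le_ciInf fun c => ?_)
    · refine NNReal.le_iInf_add_iInf fun c d => ?_
      refine (ciInf_le (OrderBot.bddBelow _) (⟨c.1 ⊔ d.1, Set.union_subset_union c.2 d.2⟩ :
        {c : Clopens G // ((Z₁ ⊔ Z₂ : Compacts G) : Set G) ⊆ c})).trans ?_
      rw [← Real.toNNReal_add (hμ _) (hμ _)]
      exact Real.toNNReal_le_toNNReal (apply_sup_le hμ _ _)
    -- A clopen `d` containing `Z₁` and missing `Z₂` splits each clopen `c ⊇ Z₁ ∪ Z₂` into covers `c
    -- ⊓ d` of `Z₁` and `c \ d` of `Z₂`.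
    · obtain ⟨d, hd1, hd2⟩ := Clopens.exists_between h₁ h₂.isOpen_compl hd.subset_compl_right
      have hc : (Z₁ : Set G) ∪ Z₂ ⊆ c.1 := c.2
      refine (add_le_add (ciInf_le (OrderBot.bddBelow _) (⟨c.1 ⊓ d, fun x hx =>
          ⟨hc (Or.inl hx), hd1 hx⟩⟩ : {c : Clopens G // (Z₁ : Set G) ⊆ c}))
        (ciInf_le (OrderBot.bddBelow _) (⟨c.1 \ d, fun x hx =>
          ⟨hc (Or.inr hx), fun hxd => hd2 hxd hx⟩⟩ : {c : Clopens G // (Z₂ : Set G) ⊆ c}))).trans ?_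
      rw [← Real.toNNReal_add (hμ _) (hμ _), ← μ.apply_sup]
      · exact Real.toNNReal_le_toNNReal (by rw [sup_comm, sup_sdiff_inf])
      · exact (disjoint_sdiff_self_left.mono_right inf_le_right).symm

theorem FinAddMeasure.content_apply [TotallyDisconnectedSpace G] (μ : FinAddMeasure (Clopens G))
    (hμ : 0 ≤ μ) (c : Clopens G) :
    μ.content hμ ⟨c, c.isClopen.isClosed.isCompact⟩ = ENNReal.ofReal (μ c) := by
  refine congrArg ENNReal.ofNNReal (le_antisymm ?_ ?_)
  · exact ciInf_le (OrderBot.bddBelow _) (⟨c, subset_rfl⟩ : {d : Clopens G // (c : Set G) ⊆ d})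
  · have : Nonempty {d : Clopens G // (c : Set G) ⊆ d} := ⟨⟨c, subset_rfl⟩⟩
    exact le_ciInf fun d => Real.toNNReal_le_toNNReal (apply_mono hμ d.2)

/-- A positive finitely additive measure on the clopen sets extends to a regular measure. -/
theorem FinAddMeasure.exists_regular_measure [TotallyDisconnectedSpace G] [MeasurableSpace G]
    [BorelSpace G] {μ : FinAddMeasure (Clopens G)} (hμ : 0 ≤ μ) :
    ∃ m : Measure G, IsFiniteMeasure m ∧ m.Regular ∧ ∀ c : Clopens G, m.real c = μ c := by
  -- A clopen set is both open and compact, so measure, inner content and content agree on it.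
  have key : ∀ c : Clopens G, (μ.content hμ).measure c = ENNReal.ofReal (μ c) := by
    intro c
    rw [Content.measure_apply _ c.measurableSet_coe,
      Content.outerMeasure_of_isOpen _ _ c.isClopen.isOpen,
      Content.innerContent_of_isCompact _ c.isClopen.isClosed.isCompact c.isClopen.isOpen,
      content_apply]
  refine ⟨(μ.content hμ).measure, ⟨?_⟩, inferInstance, fun c => ?_⟩
  · exact (key ⊤).trans_lt ENNReal.ofReal_lt_top
  · rw [measureReal_def, key, ENNReal.toReal_ofReal (hμ c)]

/-! ### Signed measures -/

variable [MeasurableSpace G] [BorelSpace G]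

theorem RegularSignedMeasure.abs_apply_le (μ : RegularSignedMeasure G) (A : Set G) :
    |μ.1 A| ≤ μ.1.totalVariation.real A :=
  μ.1.norm_le_totalVariation A

/-- Restricting a regular signed measure to the clopen sets. -/
def RegularSignedMeasure.restrict : RegularSignedMeasure G →ₗ[ℝ] FinAddMeasure (Clopens G) where
  toFun μ := ⟨fun c => μ.1 c, fun a b hab =>
      VectorMeasure.of_union (Clopens.disjoint_coe_iff.2 hab) a.measurableSet_coe
        b.measurableSet_coe,
    μ.1.totalVariation.real Set.univ, fun c =>
      (abs_apply_le μ _).trans (measureReal_mono (Set.subset_univ _))⟩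
  map_add' _ _ := rfl
  map_smul' _ _ := rfl

theorem RegularSignedMeasure.restrict_apply (μ : RegularSignedMeasure G) (c : Clopens G) :
    RegularSignedMeasure.restrict μ c = μ.1 c := rfl

instance : IsOrderedAddMonoid (RegularSignedMeasure G) where
  add_le_add_left _ _ h ρ A hA := add_le_add_left (h A hA) (ρ.1 A)

/-- Regularity and a clopen `c` squeezed between a compact subset and an open superset of `A` make
the variation of `A \ c` and `c \ A` small, so `μ A` is within `ε` of `μ c ≥ 0`. -/
theorem RegularSignedMeasure.nonneg_of_restrict_nonneg [TotallyDisconnectedSpace G]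
    {μ : RegularSignedMeasure G} (hμ : 0 ≤ RegularSignedMeasure.restrict μ) : 0 ≤ μ := by
  intro A hA
  have hreg : μ.1.totalVariation.Regular := μ.2
  change 0 ≤ μ.1 A
  refine le_of_forall_pos_le_add fun ε hε => ?_
  have hε' : ENNReal.ofReal (ε / 2) ≠ 0 := by simpa using hε
  obtain ⟨Z, hZA, hZ, hlt⟩ := hA.exists_isCompact_sdiff_lt (μ := μ.1.totalVariation)
    (measure_ne_top _ _) hε'
  obtain ⟨U, hAU, hU, -, hlt'⟩ := hA.exists_isOpen_sdiff_lt (μ := μ.1.totalVariation)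
    (measure_ne_top _ _) hε'
  obtain ⟨c, hZc, hcU⟩ := Clopens.exists_between hZ.isClosed hU (hZA.trans hAU)
  have hc := c.measurableSet_coe
  have h1 : |μ.1 (A \ c)| ≤ ε / 2 := (abs_apply_le μ _).trans
    (ENNReal.toReal_le_of_le_ofReal (by positivity)
      ((measure_mono (Set.sdiff_subset_sdiff_right hZc)).trans hlt.le))
  have h2 : |μ.1 (c \ A)| ≤ ε / 2 := (abs_apply_le μ _).trans
    (ENNReal.toReal_le_of_le_ofReal (by positivity)
      ((measure_mono (Set.sdiff_subset_sdiff_left hcU)).trans hlt'.le))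
  have h3 : μ.1 (A ∩ c) + μ.1 (A \ c) = μ.1 A := by
    rw [← VectorMeasure.of_union Set.disjoint_sdiff_inter.symm (hA.inter hc) (hA.diff hc),
      Set.inter_union_sdiff]
  have h4 : μ.1 ((c : Set G) ∩ A) + μ.1 (c \ A) = μ.1 c := by
    rw [← VectorMeasure.of_union Set.disjoint_sdiff_inter.symm (hc.inter hA) (hc.diff hA),
      Set.inter_union_sdiff]
  have h5 : 0 ≤ μ.1 c := hμ c
  rw [Set.inter_comm] at h4
  have := abs_le.1 h1
  have := abs_le.1 h2
  linarith

theorem RegularSignedMeasure.totalVariation_real_univ {μ : RegularSignedMeasure G} (hμ : 0 ≤ μ) :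
    μ.1.totalVariation.real Set.univ = μ.1 Set.univ := by
  have h : 0 ≤[Set.univ] μ.1 := (VectorMeasure.le_restrict_univ_iff_le _ _).2 hμ
  have h' := μ.1.toMeasureOfZeroLE_toSignedMeasure h
  have := SignedMeasure.toMeasureOfZeroLE_finite (s := μ.1) h MeasurableSet.univ
  conv_lhs => rw [SignedMeasure.totalVariation_eq_variation, ← h',
    Measure.variation_toSignedMeasure]
  conv_rhs => rw [← h', Measure.toSignedMeasure_apply_measurable MeasurableSet.univ]

theorem RegularSignedMeasure.normOrderIsomorphic [TotallyDisconnectedSpace G] :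
    NormOrderIsomorphic (RegularSignedMeasure G) (FinAddMeasure (Clopens G)) := by
  refine .of_linearMap RegularSignedMeasure.restrict
    (fun μ => ⟨nonneg_of_restrict_nonneg, fun h c => h c c.measurableSet_coe⟩)
    (fun μ hμ => ?_) (fun μ => FinAddMeasure.norm_le fun s hs => ?_) (fun μ ν hμ hν => ?_)
  · obtain ⟨m, _, hreg, hm⟩ := FinAddMeasure.exists_regular_measure hμ
    refine ⟨⟨m.toSignedMeasure, ?_⟩, FinAddMeasure.ext fun c => ?_⟩
    · change (SignedMeasure.totalVariation _).Regular
      rwa [SignedMeasure.totalVariation_eq_variation, Measure.variation_toSignedMeasure]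
    · rw [restrict_apply, ← hm c]
      exact Measure.toSignedMeasure_apply_measurable c.measurableSet_coe
  · have hd : (s : Set (Clopens G)).PairwiseDisjoint fun c => (c : Set G) :=
      fun a ha b hb hab => Clopens.disjoint_coe_iff.2 (hs ha hb hab)
    calc ∑ c ∈ s, |RegularSignedMeasure.restrict μ c|
        ≤ ∑ c ∈ s, μ.1.totalVariation.real c := Finset.sum_le_sum fun c _ => abs_apply_le μ _
      _ = μ.1.totalVariation.real (⋃ c ∈ s, (c : Set G)) :=
        (measureReal_biUnion_finset hd fun c _ => c.measurableSet_coe).symm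
      _ ≤ ‖μ‖ := measureReal_mono (Set.subset_univ _)
  · change (μ.1 - ν.1).totalVariation.real Set.univ ≤ μ.1 Set.univ + ν.1 Set.univ
    rw [← totalVariation_real_univ hμ, ← totalVariation_real_univ hν]
    simp only [measureReal_def]
    rw [← ENNReal.toReal_add (measure_ne_top _ _) (measure_ne_top _ _)]
    refine ENNReal.toReal_mono (by finiteness) ?_
    simp only [SignedMeasure.totalVariation_eq_variation]
    exact VectorMeasure.variation_sub_le _

end Clopens

/-! ### The dual of a space of continuous functions -/

namespace LatticeDual

variable {E : Type*} [NormedAddCommGroup E] [NormedSpace ℝ E]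

@[simp] theorem zero_apply (f : E) : (0 : LatticeDual E) f = 0 := rfl
@[simp] theorem add_apply (φ ψ : LatticeDual E) (f : E) : (φ + ψ) f = φ f + ψ f := rfl
@[simp] theorem sub_apply (φ ψ : LatticeDual E) (f : E) : (φ - ψ) f = φ f - ψ f := rfl

theorem abs_apply_le (φ : LatticeDual E) (f : E) : |φ f| ≤ ‖φ‖ * ‖f‖ :=
  ContinuousLinearMap.le_opNorm (show E →L[ℝ] ℝ from φ) f

theorem norm_le {φ : LatticeDual E} {C : ℝ} (hC : 0 ≤ C) (h : ∀ f, |φ f| ≤ C * ‖f‖) : ‖φ‖ ≤ C :=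
  ContinuousLinearMap.opNorm_le_bound (show E →L[ℝ] ℝ from φ) hC h

instance [Lattice E] [IsOrderedAddMonoid E] : IsOrderedAddMonoid (LatticeDual E) where
  add_le_add_left _ _ h ρ f hf := add_le_add_left (h f hf) (ρ f)

theorem mono [Lattice E] [IsOrderedAddMonoid E] {φ : LatticeDual E} (hφ : 0 ≤ φ) {f g : E}
    (h : f ≤ g) : φ f ≤ φ g := by
  have : 0 ≤ φ (g - f) := hφ _ (sub_nonneg.2 h)
  rw [map_sub] at this
  linarith

/-- Isometric linear order isomorphisms induce such isomorphisms of the duals. -/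
theorem normOrderIsomorphic_congr [Lattice E] [IsOrderedAddMonoid E] {F : Type*}
    [NormedAddCommGroup F] [NormedSpace ℝ F] [Lattice F] [IsOrderedAddMonoid F]
    (S : E ≃ₗᵢ[ℝ] F) (hS : ∀ e, 0 ≤ S e ↔ 0 ≤ e) :
    NormOrderIsomorphic (LatticeDual E) (LatticeDual F) := by
  let e : E ≃L[ℝ] F := S.toContinuousLinearEquiv
  let T : LatticeDual E ≃ₗ[ℝ] LatticeDual F :=
    { toFun := fun φ => (show E →L[ℝ] ℝ from φ).comp (e.symm : F →L[ℝ] E)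
      invFun := fun φ => (show F →L[ℝ] ℝ from φ).comp (e : E →L[ℝ] F)
      map_add' := fun _ _ => rfl
      map_smul' := fun _ _ => rfl
      left_inv := fun φ => DFunLike.ext _ _ fun f => congrArg φ (S.symm_apply_apply f)
      right_inv := fun φ => DFunLike.ext _ _ fun f => congrArg φ (S.apply_symm_apply f) }
  have hT : ∀ φ f, T φ f = φ (S.symm f) := fun _ _ => rfl
  refine ⟨T, fun φ => le_antisymm ?_ ?_, fun φ ψ => ⟨fun h f hf => ?_, fun h f hf => ?_⟩⟩
  · refine norm_le (norm_nonneg _) fun f => ?_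
    rw [hT, ← S.symm.norm_map f]
    exact φ.abs_apply_le _
  · refine norm_le (norm_nonneg _) fun f => ?_
    have := (T φ).abs_apply_le (S f)
    rwa [hT, S.symm_apply_apply, S.norm_map] at this
  · have := h (S f) ((hS f).2 hf)
    rwa [hT, hT, S.symm_apply_apply] at this
  · rw [hT, hT]
    exact h _ ((hS _).1 (by rwa [S.apply_symm_apply]))

end LatticeDual

section ContinuousMap

variable {G : Type*} [TopologicalSpace G]

/-- The indicator function of a clopen set, as a continuous function. -/
noncomputable def TopologicalSpace.Clopens.indicator (c : Clopens G) : C(G, ℝ) :=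
  ⟨Set.indicator c 1, c.isClopen.continuous_indicator continuous_one⟩

theorem TopologicalSpace.Clopens.indicator_of_mem {c : Clopens G} {x : G} (h : x ∈ c) :
    c.indicator x = 1 := Set.indicator_of_mem h 1

theorem TopologicalSpace.Clopens.indicator_of_notMem {c : Clopens G} {x : G} (h : x ∉ c) :
    c.indicator x = 0 := Set.indicator_of_notMem h 1

theorem TopologicalSpace.Clopens.indicator_nonneg (c : Clopens G) : 0 ≤ c.indicator := fun x =>
  Set.indicator_nonneg (fun _ _ => zero_le_one) x

theorem TopologicalSpace.Clopens.indicator_le_one (c : Clopens G) : c.indicator ≤ 1 := fun x =>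
  Set.indicator_le_self' (fun _ _ => zero_le_one) x

theorem TopologicalSpace.Clopens.indicator_sup {a b : Clopens G} (h : Disjoint a b) :
    (a ⊔ b).indicator = a.indicator + b.indicator := by
  ext x
  exact congrFun (Set.indicator_union_of_disjoint (Clopens.disjoint_coe_iff.2 h) 1) x

@[simp] theorem TopologicalSpace.Clopens.indicator_top : (⊤ : Clopens G).indicator = 1 := by
  ext x
  exact indicator_of_mem trivial

variable [CompactSpace G]

theorem ContinuousMap.le_norm_smul_one (f : C(G, ℝ)) : f ≤ ‖f‖ • (1 : C(G, ℝ)) := fun x => by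
  simpa using (le_abs_self _).trans (f.norm_coe_le_norm x)

theorem ContinuousMap.norm_one_le : ‖(1 : C(G, ℝ))‖ ≤ 1 :=
  (ContinuousMap.norm_le _ zero_le_one).2 fun x => by simp

namespace LatticeDual

/-- The finitely additive measure on the clopen sets that a functional on `C(G)` defines. -/
noncomputable def toFinAddMeasure : LatticeDual C(G, ℝ) →ₗ[ℝ] FinAddMeasure (Clopens G) where
  toFun φ := ⟨fun c => φ c.indicator, fun a b hab => by
      change φ (a ⊔ b).indicator = φ a.indicator + φ b.indicator
      rw [Clopens.indicator_sup hab, map_add],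
    ‖φ‖, fun c => by
      refine (φ.abs_apply_le _).trans (mul_le_of_le_one_right (norm_nonneg _) ?_)
      refine (ContinuousMap.norm_le _ zero_le_one).2 fun x => ?_
      rw [Real.norm_of_nonneg (show 0 ≤ c.indicator x from c.indicator_nonneg x)]
      exact c.indicator_le_one x⟩
  map_add' _ _ := rfl
  map_smul' _ _ := rfl

theorem toFinAddMeasure_apply (φ : LatticeDual C(G, ℝ)) (c : Clopens G) :
    toFinAddMeasure φ c = φ c.indicator := rfl

/-- The evaluation functional at a point. -/
noncomputable def eval (x : G) : LatticeDual C(G, ℝ) :=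
  show C(G, ℝ) →L[ℝ] ℝ from ContinuousMap.evalCLM ℝ x

@[simp] theorem eval_apply (x : G) (f : C(G, ℝ)) : eval x f = f x := rfl

/-- Disjointness keeps the signed sum `f` of indicators in the unit ball, while `φ f` is the sum of
the `|φ c.indicator|`. -/
theorem norm_toFinAddMeasure_le (φ : LatticeDual C(G, ℝ)) : ‖toFinAddMeasure φ‖ ≤ ‖φ‖ := by
  refine FinAddMeasure.norm_le fun s hs => ?_
  let f : C(G, ℝ) := ∑ c ∈ s, (SignType.sign (φ c.indicator) : ℝ) • c.indicator
  have hf : ‖f‖ ≤ 1 := by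
    refine (ContinuousMap.norm_le _ zero_le_one).2 fun x => ?_
    calc ‖f x‖ = ‖∑ c ∈ s, (SignType.sign (φ c.indicator) : ℝ) * c.indicator x‖ := by
          simp [f, ContinuousMap.coe_sum]
      _ ≤ ∑ c ∈ s, ‖(SignType.sign (φ c.indicator) : ℝ) * c.indicator x‖ := norm_sum_le _ _
      -- Evaluation at `x` is itself a finitely additive measure, so the indicators add up to that
      -- of the join.
      _ ≤ ∑ c ∈ s, toFinAddMeasure (eval x) c := by
          refine Finset.sum_le_sum fun c _ => ?_
          have h := c.indicator_nonneg x
          change 0 ≤ c.indicator x at h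
          rw [toFinAddMeasure_apply, eval_apply, norm_mul, Real.norm_of_nonneg h]
          refine mul_le_of_le_one_left h ?_
          rcases SignType.sign (φ c.indicator) <;> simp
      _ = toFinAddMeasure (eval x) (s.sup id) := FinAddMeasure.sum_apply _ hs
      _ ≤ 1 := (s.sup id).indicator_le_one x
  calc ∑ c ∈ s, |toFinAddMeasure φ c| = φ f := by
        simp only [f, map_sum, map_smul, smul_eq_mul, toFinAddMeasure_apply, sign_mul_self]
    _ ≤ ‖φ‖ * ‖f‖ := (le_abs_self _).trans (φ.abs_apply_le f)
    _ ≤ ‖φ‖ := mul_le_of_le_one_right (norm_nonneg _) hf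

theorem norm_sub_le_add {φ ψ : LatticeDual C(G, ℝ)} (hφ : 0 ≤ φ) (hψ : 0 ≤ ψ) :
    ‖φ - ψ‖ ≤ φ 1 + ψ 1 := by
  have h1 : ∀ {φ : LatticeDual C(G, ℝ)}, 0 ≤ φ → ∀ f, |φ f| ≤ φ 1 * ‖f‖ := by
    intro φ hφ f
    have h := mono hφ f.le_norm_smul_one
    have h' := mono hφ (-f).le_norm_smul_one
    rw [map_smul, smul_eq_mul] at h h'
    rw [map_neg, norm_neg] at h'
    rw [abs_le]
    constructor <;> linarith
  have h0 : (0 : C(G, ℝ)) ≤ 1 := fun _ => zero_le_one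
  refine norm_le (add_nonneg (hφ 1 h0) (hψ 1 h0)) fun f => ?_
  rw [sub_apply, add_mul]
  exact (abs_sub _ _).trans (add_le_add (h1 hφ f) (h1 hψ f))

variable [T2Space G] [TotallyDisconnectedSpace G]

/-- If `0 ≤ f ≤ M`, a clopen `c` between `{f ≥ 2M/3}` and `{f > M/3}` gives `0 ≤ f - (M/3) 1_c ≤
2M/3`, and `φ` is nonnegative on the part removed. After `n` rounds only an error `‖φ‖ M (2/3)^n`
remains. -/
theorem nonneg_of_toFinAddMeasure_nonneg {φ : LatticeDual C(G, ℝ)}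
    (hφ : 0 ≤ toFinAddMeasure φ) : 0 ≤ φ := by
  have step : ∀ n : ℕ, ∀ M : ℝ, 0 ≤ M → ∀ f : C(G, ℝ), 0 ≤ f → (∀ x, f x ≤ M) →
      -(‖φ‖ * (M * (2 / 3) ^ n)) ≤ φ f := by
    intro n
    induction n with
    | zero =>
      intro M hM f hf hfM
      have h : ‖f‖ ≤ M := (ContinuousMap.norm_le _ hM).2 fun x => by
        rw [Real.norm_of_nonneg (show 0 ≤ f x from hf x)]; exact hfM x
      have h' := (abs_le.1 (φ.abs_apply_le f)).1
      have := mul_le_mul_of_nonneg_left h (norm_nonneg φ)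
      simp only [pow_zero, mul_one]
      linarith
    | succ n ih =>
      intro M hM f hf hfM
      -- The two level sets can be separated only when `M > 0`.
      rcases hM.eq_or_lt with rfl | hM
      · have : f = 0 := by
          ext x
          exact le_antisymm (hfM x) (hf x)
        simp [this]
      obtain ⟨c, hc1, hc2⟩ := Clopens.exists_between
        (isClosed_le (continuous_const (y := 2 / 3 * M)) f.continuous)
        (isOpen_lt (continuous_const (y := 1 / 3 * M)) f.continuous)
        (fun x (hx : 2 / 3 * M ≤ f x) => show 1 / 3 * M < f x by linarith)
      have key := ih (2 / 3 * M) (by positivity) (f - (1 / 3 * M) • c.indicator) (fun x => ?_)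
        (fun x => ?_)
      · have h : 0 ≤ φ c.indicator := hφ c
        have h' : 0 ≤ 1 / 3 * M * φ c.indicator := by positivity
        rw [map_sub, map_smul, smul_eq_mul] at key
        rw [pow_succ]
        linarith
      · change 0 ≤ f x - 1 / 3 * M * c.indicator x
        by_cases hx : x ∈ c
        · have : 1 / 3 * M < f x := hc2 hx
          rw [Clopens.indicator_of_mem hx]
          linarith
        · rw [Clopens.indicator_of_notMem hx, mul_zero, sub_zero]
          exact hf x
      · change f x - 1 / 3 * M * c.indicator x ≤ 2 / 3 * M
        by_cases hx : x ∈ c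
        · have := hfM x
          rw [Clopens.indicator_of_mem hx]
          linarith
        · have : ¬ 2 / 3 * M ≤ f x := fun h => hx (hc1 h)
          rw [Clopens.indicator_of_notMem hx]
          linarith
  intro f hf
  have hlim : Filter.Tendsto (fun n : ℕ => -(‖φ‖ * (‖f‖ * (2 / 3 : ℝ) ^ n))) Filter.atTop
      (nhds 0) := by
    have h := ((tendsto_pow_atTop_nhds_zero_of_lt_one (r := (2 / 3 : ℝ)) (by norm_num)
      (by norm_num)).const_mul ‖f‖).const_mul ‖φ‖
    simpa using h.neg
  exact le_of_tendsto' hlim fun n => step n ‖f‖ (norm_nonneg _) f hf fun x => by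
    simpa using f.le_norm_smul_one x

theorem normOrderIsomorphic :
    NormOrderIsomorphic (LatticeDual C(G, ℝ)) (FinAddMeasure (Clopens G)) := by
  refine .of_linearMap toFinAddMeasure
    (fun φ => ⟨nonneg_of_toFinAddMeasure_nonneg, fun h c => h _ c.indicator_nonneg⟩)
    (fun μ hμ => ?_) norm_toFinAddMeasure_le (fun φ ψ hφ hψ => ?_)
  · let _ : MeasurableSpace G := borel G
    have : BorelSpace G := ⟨rfl⟩
    obtain ⟨m, _, -, hm⟩ := FinAddMeasure.exists_regular_measure hμ
    have hint : ∀ f : C(G, ℝ), Integrable f m := fun f =>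
      f.continuous.integrable_of_hasCompactSupport (HasCompactSupport.of_compactSpace f)
    -- The preimage of `μ` is integration against its regular extension.
    let I : C(G, ℝ) →ₗ[ℝ] ℝ :=
      { toFun := fun f => ∫ x, f x ∂m
        map_add' := fun f g => integral_add (hint f) (hint g)
        map_smul' := fun c f => integral_const_mul c f }
    let φ : C(G, ℝ) →L[ℝ] ℝ := I.mkContinuous (m.real Set.univ) fun f => by
      rw [mul_comm]
      exact norm_integral_le_of_norm_le_const (Filter.Eventually.of_forall f.norm_coe_le_norm)
    refine ⟨φ, FinAddMeasure.ext fun c => ?_⟩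
    rw [← hm c]
    exact integral_indicator_one c.measurableSet_coe
  · rw [toFinAddMeasure_apply, toFinAddMeasure_apply, Clopens.indicator_top]
    exact norm_sub_le_add hφ hψ

end LatticeDual

end ContinuousMap

/-! ### Dedekind completions -/

section Stonean

variable {G : Type*} [TopologicalSpace G]

/-- The continuous functions on an extremally disconnected space form a Dedekind complete
lattice. -/
theorem ContinuousMap.exists_isLUB_of_extremallyDisconnected [ExtremallyDisconnected G]
    {s : Set C(G, ℝ)} (hs : s.Nonempty) (hb : BddAbove s) : ∃ g, IsLUB s g := by
  obtain ⟨f₀, hf₀⟩ := hs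
  let U : ℝ → Set G := fun t => ⋃ f ∈ s, {y | t < f y}
  have hUopen : ∀ t, IsOpen (U t) := fun t =>
    isOpen_biUnion fun f _ => isOpen_lt continuous_const f.continuous
  have hUanti : ∀ t t', t ≤ t' → U t' ⊆ U t := by
    intro t t' h x hx
    simp only [U, Set.mem_iUnion] at hx ⊢
    obtain ⟨f, hf, hx⟩ := hx
    exact ⟨f, hf, h.trans_lt hx⟩
  have hmem : ∀ f ∈ s, ∀ x t, t < f x → x ∈ closure (U t) := fun f hf x t h =>
    subset_closure (Set.mem_biUnion hf h)
  have hle : ∀ k ∈ upperBounds s, ∀ x t, x ∈ closure (U t) → t ≤ k x := by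
    intro k hk x t hx
    refine closure_minimal ?_ (isClosed_le continuous_const k.continuous) hx
    intro y hy
    simp only [U, Set.mem_iUnion] at hy
    obtain ⟨f, hf, hy⟩ := hy
    exact (le_of_lt hy).trans (hk hf y)
  -- Replacing each superlevel set `U t` of the pointwise supremum by its closure makes the function
  -- `x ↦ sSup (A x)` continuous; it is the least upper bound.
  let A : G → Set ℝ := fun x => {t | x ∈ closure (U t)}
  have hAne : ∀ x, (A x).Nonempty := fun x => ⟨f₀ x - 1, hmem f₀ hf₀ x _ (by linarith)⟩
  obtain ⟨b, hb⟩ := hb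
  have hAbdd : ∀ x, BddAbove (A x) := fun x => ⟨b x, fun t ht => hle b hb x t ht⟩
  have hcont : Continuous fun x => sSup (A x) := by
    rw [OrderTopology.continuous_iff]
    refine fun t => ⟨?_, ?_⟩
    -- Lower semicontinuity is where extremal disconnectedness enters: the closures are open.
    · have : (fun x => sSup (A x)) ⁻¹' Set.Ioi t = ⋃ t' ∈ Set.Ioi t, closure (U t') := by
        ext x
        simp only [Set.mem_preimage, Set.mem_Ioi, Set.mem_iUnion, exists_prop]
        refine ⟨fun h => ?_, fun ⟨t', h, hx⟩ => h.trans_le (le_csSup (hAbdd x) hx)⟩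
        obtain ⟨t', ht', h⟩ := exists_lt_of_lt_csSup (hAne x) h
        exact ⟨t', h, ht'⟩
      rw [this]
      exact isOpen_biUnion fun t' _ => ExtremallyDisconnected.open_closure _ (hUopen t')
    · have : (fun x => sSup (A x)) ⁻¹' Set.Iio t = ⋃ t' ∈ Set.Iio t, (closure (U t'))ᶜ := by
        ext x
        simp only [Set.mem_preimage, Set.mem_Iio, Set.mem_iUnion, exists_prop]
        refine ⟨fun h => ?_, fun ⟨t', h, hx⟩ => lt_of_le_of_lt (csSup_le (hAne x) ?_) h⟩
        · obtain ⟨t', h1, h2⟩ := exists_between h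
          exact ⟨t', h2, fun hx => h1.not_ge (le_csSup (hAbdd x) hx)⟩
        · intro r hr
          by_contra! hlt
          exact hx (closure_mono (hUanti _ _ hlt.le) hr)
      rw [this]
      exact isOpen_biUnion fun t' _ => isClosed_closure.isOpen_compl
  refine ⟨⟨_, hcont⟩, fun f hf x => ?_, fun k hk x => csSup_le (hAne x) (hle k hk x)⟩
  exact le_of_forall_lt_imp_le_of_dense fun t ht => le_csSup (hAbdd x) (hmem f hf x t ht)

instance [CompactSpace G] : HasSolidNorm C(G, ℝ) where
  solid f g h := by
    refine (ContinuousMap.norm_le _ (norm_nonneg _)).2 fun x => ?_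
    have h' : |f x| ≤ |g x| := h x
    exact h'.trans (g.norm_coe_le_norm x)

/-- The continuous functions on a Gleason cover of `K` are a Dedekind completion of `C(K)`. -/
theorem IsGleasonCover.isDedekindCompletion {K : Type*} [TopologicalSpace K] [CompactSpace K]
    [T2Space K] [CompactSpace G] {π : C(G, K)} (h : IsGleasonCover π) :
    IsDedekindCompletion (E := C(G, ℝ)) (ContinuousMap.compRightAlgHom ℝ ℝ π).toLinearMap where
  exists_isLUB s hs hb := by
    have := h.extremallyDisconnected
    exact ContinuousMap.exists_isLUB_of_extremallyDisconnected hs hb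
  norm_map f := by
    change ‖f.comp π‖ = ‖f‖
    refine le_antisymm ((ContinuousMap.norm_le _ (norm_nonneg _)).2 fun x =>
      f.norm_coe_le_norm (π x)) ((ContinuousMap.norm_le _ (norm_nonneg _)).2 fun y => ?_)
    obtain ⟨x, rfl⟩ := h.surjective y
    exact (f.comp π).norm_coe_le_norm x
  map_sup _ _ := rfl
  map_inf _ _ := rfl
  majorizing e _ := ⟨‖e‖ • (1 : C(K, ℝ)), fun x => e.le_norm_smul_one x⟩
  orderDense e he := by
    obtain ⟨x, hx⟩ : ∃ x, 0 < e x := by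
      by_contra! hcon
      exact he.not_ge hcon
    -- Irreducibility gives a fibre, over `y`, on which `e > e x / 2`. A Urysohn function that is
    -- `1` at `y` and vanishes off the open set of all such points, scaled by `e x / 2` and pulled
    -- back, lies below `e`.
    obtain ⟨y, hy⟩ := h.nonempty_compl_image_compl
      (isOpen_lt (continuous_const (y := e x / 2)) e.continuous)
      ⟨x, show e x / 2 < e x by linarith⟩
    have hU := h.isOpen_compl_image_compl
      (isOpen_lt (continuous_const (y := e x / 2)) e.continuous)
    obtain ⟨f, hf0, hf1, hf⟩ := exists_continuous_zero_one_of_isClosed hU.isClosed_compl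
      (isClosed_singleton (x := y)) (Set.disjoint_singleton_right.2 fun h => h hy)
    obtain ⟨z, rfl⟩ := h.surjective y
    refine ⟨(e x / 2) • f, lt_of_le_of_ne (fun g => ?_) (fun h0 => ?_), fun g => ?_⟩
    · exact mul_nonneg (by linarith) (hf (π g)).1
    · have h1 : (0 : ℝ) = e x / 2 * f (π z) := DFunLike.congr_fun h0 z
      rw [hf1 rfl, Pi.one_apply] at h1
      linarith
    · change e x / 2 * f (π g) ≤ e g
      by_cases hg : π g ∈ (π '' {y | e x / 2 < e y}ᶜ)ᶜ
      · have h1 : e x / 2 < e g := preimage_compl_image_compl_subset {y | e x / 2 < e y} hg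
        exact (mul_le_of_le_one_right (by linarith) (hf (π g)).2).trans h1.le
      · rw [hf0 hg, Pi.zero_apply, mul_zero]
        exact he.le g

end Stonean

set_option linter.unusedSectionVars false

/-! ### Order and norm of a Dedekind completion -/

namespace IsDedekindCompletion

variable {K : Type*} [TopologicalSpace K] [CompactSpace K]
  {E : Type*} [NormedAddCommGroup E] [NormedSpace ℝ E] [Lattice E] {j : C(K, ℝ) →ₗ[ℝ] E}

theorem injective (h : IsDedekindCompletion j) : Function.Injective j := by
  rw [injective_iff_map_eq_zero]
  intro f hf
  rw [← norm_eq_zero, ← h.norm_map, hf, norm_zero]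

theorem le_iff (h : IsDedekindCompletion j) {f g : C(K, ℝ)} : j f ≤ j g ↔ f ≤ g := by
  rw [← inf_eq_left, ← h.map_inf, h.injective.eq_iff, inf_eq_left]

variable [IsOrderedAddMonoid E]

theorem exists_le_map (h : IsDedekindCompletion j) (e : E) : ∃ f, e ≤ j f :=
  (h.majorizing |e| (abs_nonneg e)).imp fun _ hf => (le_abs_self e).trans hf

theorem exists_map_le (h : IsDedekindCompletion j) (e : E) : ∃ f, j f ≤ e := by
  obtain ⟨f, hf⟩ := h.exists_le_map (-e)
  exact ⟨-f, by rw [map_neg]; exact neg_le.1 hf⟩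

variable [HasSolidNorm E]

/-- If an upper bound `x` failed `e ≤ x`, order density would give `0 < j f ≤ e - e ⊓ x`. Starting
from some `j g ≤ e`, adding `f` never leaves the lower cut of `e`, so `n ‖j f‖ ≤ ‖e - j g‖` for all
`n`, which is absurd. -/
theorem isLUB (h : IsDedekindCompletion j) (e : E) : IsLUB (j '' {f | j f ≤ e}) e := by
  refine ⟨by rintro _ ⟨f, hf, rfl⟩; exact hf, fun x hx => ?_⟩
  by_contra hex
  have hlt : 0 < e - e ⊓ x := sub_pos.2 (inf_lt_left.2 hex)
  obtain ⟨f, hf, hfd⟩ := h.orderDense _ hlt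
  obtain ⟨g, hg⟩ := h.exists_map_le e
  have step : ∀ n : ℕ, j (g + n • f) ≤ e := by
    intro n
    induction n with
    | zero => simpa using hg
    | succ n ih =>
      have h1 : j (g + n • f) ≤ e ⊓ x := le_inf ih (hx ⟨_, ih, rfl⟩)
      rw [succ_nsmul, ← add_assoc, map_add]
      calc _ ≤ e ⊓ x + (e - e ⊓ x) := add_le_add h1 hfd
        _ = e := by abel
  have hbd : ∀ n : ℕ, n * ‖j f‖ ≤ ‖e - j g‖ := by
    intro n
    have h1 := step n
    rw [map_add, add_comm, ← le_sub_iff_add_le, map_nsmul] at h1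
    have h2 : 0 ≤ n • j f := nsmul_nonneg hf.le n
    have h3 := norm_le_norm_of_abs_le_abs
      (show |n • j f| ≤ |e - j g| by rwa [abs_of_nonneg h2, abs_of_nonneg (h2.trans h1)])
    rwa [← Nat.cast_smul_eq_nsmul ℝ, norm_smul, Real.norm_natCast] at h3
  obtain ⟨n, hn⟩ := exists_nat_gt (‖e - j g‖ / ‖j f‖)
  rw [div_lt_iff₀ (norm_pos_iff.2 hf.ne')] at hn
  exact hn.not_ge (hbd n)

theorem le_of_forall_map_le (h : IsDedekindCompletion j) {e e' : E}
    (hle : ∀ f, j f ≤ e → j f ≤ e') : e ≤ e' :=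
  (h.isLUB e).2 (by rintro _ ⟨f, hf, rfl⟩; exact hle f hf)

theorem le_of_forall_le_map (h : IsDedekindCompletion j) {e e' : E}
    (hle : ∀ f, e' ≤ j f → e ≤ j f) : e ≤ e' := by
  refine neg_le_neg_iff.1 (h.le_of_forall_map_le fun f hf => ?_)
  have := hle (-f) (by rw [map_neg]; exact le_neg.1 hf)
  rw [map_neg] at this
  exact le_neg.1 this

/-- Each `j f ≤ e` has `j (f ⊔ 0) ≤ |e|`, so `‖f ⊔ 0‖ ≤ ‖e‖` by solidity. With `norm_le_of_le` this
makes `j 1` an order unit defining the norm, so the norm is determined by the order and `j`. -/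
theorem le_norm_smul (h : IsDedekindCompletion j) (e : E) : e ≤ j (‖e‖ • 1) := by
  refine h.le_of_forall_map_le fun f hf => h.le_iff.2 ?_
  have h1 : j (f ⊔ 0) ≤ |e| := by
    rw [h.map_sup, map_zero]
    exact sup_le (hf.trans (le_abs_self e)) (abs_nonneg e)
  have h2 : 0 ≤ j (f ⊔ 0) := by
    rw [h.map_sup, map_zero]
    exact le_sup_right
  have h3 : ‖f ⊔ 0‖ ≤ ‖e‖ := by
    rw [← h.norm_map]
    exact norm_le_norm_of_abs_le_abs (by rwa [abs_of_nonneg h2])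
  intro x
  have h4 : (f ⊔ 0) x ≤ ‖f ⊔ 0‖ * 1 := (f ⊔ 0).le_norm_smul_one x
  have h5 : f x ≤ (f ⊔ 0) x := le_sup_left
  change f x ≤ ‖e‖ * 1
  linarith

theorem norm_le_of_le (h : IsDedekindCompletion j) {e : E} {c : ℝ} (hc : 0 ≤ c)
    (h1 : e ≤ j (c • 1)) (h2 : -e ≤ j (c • 1)) : ‖e‖ ≤ c := by
  have h3 : |e| ≤ |j (c • 1)| := (abs_le'.2 ⟨h1, h2⟩).trans (le_abs_self _)
  refine (norm_le_norm_of_abs_le_abs h3).trans ?_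
  rw [h.norm_map, norm_smul, Real.norm_of_nonneg hc]
  exact mul_le_of_le_one_right hc ContinuousMap.norm_one_le

/-- Elements of two Dedekind completions of `C(K)` that correspond to each other. -/
def Corresponds {E F : Type*} [NormedAddCommGroup E] [NormedSpace ℝ E] [Lattice E]
    [NormedAddCommGroup F] [NormedSpace ℝ F] [Lattice F]
    (j : C(K, ℝ) →ₗ[ℝ] E) (k : C(K, ℝ) →ₗ[ℝ] F) (e : E) (t : F) : Prop :=
  ∀ f, j f ≤ e ↔ k f ≤ t

/-! ### Uniqueness of the Dedekind completion -/

section Uniqueness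

variable {F : Type*} [NormedAddCommGroup F] [NormedSpace ℝ F] [Lattice F] [IsOrderedAddMonoid F]
  [HasSolidNorm F] {k : C(K, ℝ) →ₗ[ℝ] F}

/-- Take `t` to be the supremum of the transported lower cut of `e`. No new function slips below
`t`: if `k f ≤ t`, then `f ≤ g` whenever `e ≤ j g`, and `e` is the infimum of such `j g`. -/
theorem exists_corresponds (hj : IsDedekindCompletion j) (hk : IsDedekindCompletion k) (e : E) :
    ∃ t, Corresponds j k e t := by
  obtain ⟨t, ht⟩ := hk.exists_isLUB (k '' {f | j f ≤ e})
    (Set.Nonempty.image _ (hj.exists_map_le e)) (by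
      obtain ⟨g, hg⟩ := hj.exists_le_map e
      refine ⟨k g, ?_⟩
      rintro _ ⟨f, hf, rfl⟩
      exact hk.le_iff.2 (hj.le_iff.1 (le_trans hf hg)))
  refine ⟨t, fun f => ⟨fun hf => ht.1 ⟨f, hf, rfl⟩, fun hf => ?_⟩⟩
  refine hj.le_of_forall_le_map fun g hg => hj.le_iff.2 (hk.le_iff.1 (hf.trans (ht.2 ?_)))
  rintro _ ⟨f', hf', rfl⟩
  exact hk.le_iff.2 (hj.le_iff.1 (le_trans hf' hg))

namespace Corresponds

theorem symm {e : E} {t : F} (h : Corresponds j k e t) : Corresponds k j t e :=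
  fun f => (h f).symm

theorem map (hj : IsDedekindCompletion j) (hk : IsDedekindCompletion k) (f : C(K, ℝ)) :
    Corresponds j k (j f) (k f) := fun _ => hj.le_iff.trans hk.le_iff.symm

theorem le_of_le (hk : IsDedekindCompletion k) {e e' : E} {t t' : F} (h : Corresponds j k e t)
    (h' : Corresponds j k e' t') (hle : e ≤ e') : t ≤ t' :=
  hk.le_of_forall_map_le fun f hf => (h' f).1 (((h f).2 hf).trans hle)

theorem add_le (hk : IsDedekindCompletion k) {e e' : E} {t t' s : F} (h : Corresponds j k e t)
    (h' : Corresponds j k e' t') (hs : Corresponds j k (e + e') s) : t + t' ≤ s := by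
  rw [← le_sub_iff_add_le]
  refine hk.le_of_forall_map_le fun f hf => ?_
  rw [le_sub_comm]
  refine hk.le_of_forall_map_le fun f' hf' => ?_
  rw [le_sub_iff_add_le, add_comm, ← map_add, ← hs, map_add]
  exact add_le_add ((h f).2 hf) ((h' f').2 hf')

/-- Sums of lower cuts give only `t + t' ≤ s`; the reverse inequality comes from the same argument
with the two completions exchanged. -/
theorem add (hj : IsDedekindCompletion j) (hk : IsDedekindCompletion k) {e e' : E} {t t' : F}
    (h : Corresponds j k e t) (h' : Corresponds j k e' t') :
    Corresponds j k (e + e') (t + t') := by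
  obtain ⟨s, hs⟩ := hj.exists_corresponds hk (e + e')
  obtain ⟨d, hd⟩ := hk.exists_corresponds hj (t + t')
  have h1 : t + t' ≤ s := add_le hk h h' hs
  have h2 : e + e' ≤ d := add_le hj h.symm h'.symm hd
  rwa [h1.antisymm (le_of_le hk hs hd.symm h2)]

theorem eq (hk : IsDedekindCompletion k) {e : E} {t t' : F} (h : Corresponds j k e t)
    (h' : Corresponds j k e t') : t = t' :=
  (le_of_le hk h h' le_rfl).antisymm (le_of_le hk h' h le_rfl)

theorem neg (hj : IsDedekindCompletion j) (hk : IsDedekindCompletion k) {e : E} {t : F}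
    (h : Corresponds j k e t) : Corresponds j k (-e) (-t) := by
  obtain ⟨s, hs⟩ := hj.exists_corresponds hk (-e)
  have h0 := map hj hk 0
  have h1 := add hj hk h hs
  rw [add_neg_cancel, ← map_zero j] at h1
  have h2 := eq hk h1 h0
  rw [map_zero] at h2
  rwa [neg_eq_of_add_eq_zero_right h2]

theorem smul [IsOrderedModule ℝ E] [IsOrderedModule ℝ F] (hj : IsDedekindCompletion j)
    (hk : IsDedekindCompletion k) {e : E} {t : F} (h : Corresponds j k e t) (c : ℝ) :
    Corresponds j k (c • e) (c • t) := by
  have hpos : ∀ c : ℝ, 0 < c → Corresponds j k (c • e) (c • t) := by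
    intro c hc f
    rw [← inv_smul_le_iff_of_pos hc, ← inv_smul_le_iff_of_pos hc, ← map_smul, ← map_smul]
    exact h _
  rcases lt_trichotomy c 0 with hc | rfl | hc
  · have := neg hj hk (hpos (-c) (neg_pos.2 hc))
    rwa [neg_smul, neg_smul, neg_neg, neg_neg] at this
  · have := map hj hk 0
    rwa [map_zero, map_zero, ← zero_smul ℝ e, ← zero_smul ℝ t] at this
  · exact hpos c hc

theorem norm_le (hj : IsDedekindCompletion j) (hk : IsDedekindCompletion k) {e : E} {t : F}
    (h : Corresponds j k e t) : ‖t‖ ≤ ‖e‖ := by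
  refine hk.norm_le_of_le (norm_nonneg e)
    (le_of_le hk h (map hj hk _) (hj.le_norm_smul e))
    (le_of_le hk (neg hj hk h) (map hj hk _) ?_)
  rw [← norm_neg]
  exact hj.le_norm_smul (-e)

end Corresponds

/-- Any two Dedekind completions of `C(K)` are isometrically order isomorphic. -/
theorem exists_linearIsometryEquiv [IsOrderedModule ℝ E] [IsOrderedModule ℝ F]
    (hj : IsDedekindCompletion j) (hk : IsDedekindCompletion k) :
    ∃ S : E ≃ₗᵢ[ℝ] F, ∀ e, 0 ≤ S e ↔ 0 ≤ e := by
  choose T hT using hj.exists_corresponds hk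
  choose S hS using hk.exists_corresponds hj
  let L : E ≃ₗ[ℝ] F :=
    { toFun := T
      invFun := S
      map_add' := fun e e' => (hT _).eq hk ((hT e).add hj hk (hT e'))
      map_smul' := fun c e => (hT _).eq hk ((hT e).smul hj hk c)
      left_inv := fun e => (hS _).eq hj (hT e).symm
      right_inv := fun t => (hT _).eq hk (hS t).symm }
  have h0 : Corresponds j k 0 0 := by
    have := Corresponds.map hj hk 0
    rwa [map_zero, map_zero] at this
  exact ⟨⟨L, fun e => le_antisymm ((hT e).norm_le hj hk) ((hT e).symm.norm_le hk hj)⟩, fun e =>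
    ⟨Corresponds.le_of_le hj h0.symm (hT e).symm, Corresponds.le_of_le hk h0 (hT e)⟩⟩

end Uniqueness

end IsDedekindCompletion

/-! ### Comparison with the regular open algebra -/

section Comparison

variable {K : Type*} [TopologicalSpace K] [T2Space K] {G : Type*} [TopologicalSpace G]
  [CompactSpace G] [T2Space G] {π : C(G, K)}

theorem IsGleasonCover.normOrderIsomorphic_clopens (hπ : IsGleasonCover π) :
    NormOrderIsomorphic (FinAddMeasure (Clopens G))
      (FinAddMeasure (Heyting.Regular (Opens K))) :=
  hπ.exists_orderIso.elim FinAddMeasure.normOrderIsomorphic_of_orderIso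

theorem IsGleasonCover.normOrderIsomorphic_regularSignedMeasure [MeasurableSpace G] [BorelSpace G]
    (hπ : IsGleasonCover π) :
    NormOrderIsomorphic (RegularSignedMeasure G) (FinAddMeasure (Heyting.Regular (Opens K))) := by
  have := hπ.extremallyDisconnected
  exact RegularSignedMeasure.normOrderIsomorphic.trans hπ.normOrderIsomorphic_clopens

theorem IsDedekindCompletion.normOrderIsomorphic_latticeDual [CompactSpace K] {E : Type*}
    [NormedAddCommGroup E] [NormedSpace ℝ E] [Lattice E] [IsOrderedAddMonoid E]
    [IsOrderedModule ℝ E] [HasSolidNorm E] {j : C(K, ℝ) →ₗ[ℝ] E} (hj : IsDedekindCompletion j)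
    (hπ : IsGleasonCover π) :
    NormOrderIsomorphic (LatticeDual E) (FinAddMeasure (Heyting.Regular (Opens K))) := by
  have := hπ.extremallyDisconnected
  obtain ⟨S, hS⟩ := hj.exists_linearIsometryEquiv hπ.isDedekindCompletion
  exact ((LatticeDual.normOrderIsomorphic_congr S hS).trans
    LatticeDual.normOrderIsomorphic).trans hπ.normOrderIsomorphic_clopens

end Comparison

/-! ### The pairwise isomorphisms and the Stonean case -/

theorem mainTheorem9 {K : Type u} [TopologicalSpace K] [CompactSpace K] [T2Space K]
    [MeasurableSpace K] [BorelSpace K] :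
    -- `C(K)` has a Dedekind completion
    (∃ (E : Type u) (_ : NormedAddCommGroup E) (_ : NormedSpace ℝ E) (_ : Lattice E)
      (_ : IsOrderedAddMonoid E) (_ : IsOrderedModule ℝ E) (_ : HasSolidNorm E)
      (_ : CompleteSpace E) (j : C(K, ℝ) →ₗ[ℝ] E), IsDedekindCompletion j) ∧
    -- `K` has a Gleason cover
    (∃ (G : Type u) (_ : TopologicalSpace G) (π : C(G, K)), IsGleasonCover π) ∧
    -- the four spaces, for every choice of the Dedekind completion and of the Gleason cover
    (∀ (E : Type v) [NormedAddCommGroup E] [NormedSpace ℝ E] [Lattice E]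
      [IsOrderedAddMonoid E] [IsOrderedModule ℝ E] [HasSolidNorm E] [CompleteSpace E]
      (j : C(K, ℝ) →ₗ[ℝ] E) (_ : IsDedekindCompletion j)
      (G : Type w) [TopologicalSpace G] [CompactSpace G] [T2Space G]
      [MeasurableSpace G] [BorelSpace G] (π : C(G, K)) (_ : IsGleasonCover π),
      IsometricallyLatticeIsomorphic
        (LatticeDual E) (FinAddMeasure (Heyting.Regular (Opens K))) ∧
      IsometricallyLatticeIsomorphic (LatticeDual E) (MeagreNullMeasure K) ∧
      IsometricallyLatticeIsomorphic (LatticeDual E) (RegularSignedMeasure G) ∧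
      IsometricallyLatticeIsomorphic
        (FinAddMeasure (Heyting.Regular (Opens K))) (MeagreNullMeasure K) ∧
      IsometricallyLatticeIsomorphic
        (FinAddMeasure (Heyting.Regular (Opens K))) (RegularSignedMeasure G) ∧
      IsometricallyLatticeIsomorphic (MeagreNullMeasure K) (RegularSignedMeasure G)) ∧
    -- the three spaces for Stonean `K`
    (ExtremallyDisconnected K →
      IsometricallyLatticeIsomorphic
        (LatticeDual C(K, ℝ)) (FinAddMeasure (Heyting.Regular (Opens K))) ∧
      IsometricallyLatticeIsomorphic (LatticeDual C(K, ℝ)) (RegularSignedMeasure K) ∧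
      IsometricallyLatticeIsomorphic
        (FinAddMeasure (Heyting.Regular (Opens K))) (RegularSignedMeasure K)) := by
  have hfa := FinAddMeasure.hasBinarySupInf (Heyting.Regular (Opens K))
  have hM := MeagreNullMeasure.normOrderIsomorphic (K := K)
  refine ⟨?_, exists_isGleasonCover K, ?_, ?_⟩
  · obtain ⟨G, _, π, hπ⟩ := exists_isGleasonCover K
    have := hπ.compactSpace
    exact ⟨C(G, ℝ), inferInstance, inferInstance, inferInstance, inferInstance, inferInstance,
      inferInstance, inferInstance, _, hπ.isDedekindCompletion⟩
  · intro E _ _ _ _ _ _ _ j hj G _ _ _ _ _ π hπ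
    have hE := hj.normOrderIsomorphic_latticeDual hπ
    have hG := hπ.normOrderIsomorphic_regularSignedMeasure
    have hG' := hG.hasBinarySupInf hfa
    have hM' := hM.hasBinarySupInf hfa
    exact ⟨hE.isometricallyLatticeIsomorphic hfa,
      (hE.trans hM.symm).isometricallyLatticeIsomorphic hM',
      (hE.trans hG.symm).isometricallyLatticeIsomorphic hG',
      hM.symm.isometricallyLatticeIsomorphic hM',
      hG.symm.isometricallyLatticeIsomorphic hG',
      (hM.trans hG.symm).isometricallyLatticeIsomorphic hG'⟩
  · intro _
    -- A Stonean space is its own Gleason cover, so `C(K)` is its own Dedekind completion.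
    have hπ := IsGleasonCover.id_of_extremallyDisconnected K
    have hE := hπ.isDedekindCompletion.normOrderIsomorphic_latticeDual hπ
    have hG := hπ.normOrderIsomorphic_regularSignedMeasure
    have hG' := hG.hasBinarySupInf hfa
    exact ⟨hE.isometricallyLatticeIsomorphic hfa,
      (hE.trans hG.symm).isometricallyLatticeIsomorphic hG',
      hG.symm.isometricallyLatticeIsomorphic hG'⟩
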